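/- **Theorem (strict convexity of the even surface tension).** Let $d\ge 1$, $\beta>0$, let $V,g\in C^2(\mathbb R)$ and suppose that $U=V+g$ is symmetric, $U(-s)=U(s)$. Assume * (A0) there are $A>0$, $B\in\mathbb R$ with $U(s)\ge A|s|^2-B$ for all $s\in\mathbb R$; * (A1) $C_1\le V''\le C_2$ and $-C_0\le g''\le 0$ on $\mathbb R$, where $0<C_1<C_2<C_0$; * (A2) for some real $q\ge 1$, $g''\in L^q(\mathbb R)$ and $$\beta^{\frac1{2q}}\|g''\|_{L^q(\mathbb R)}<\frac{C_1^{3/2}}{2\,C_2^{\frac{q+1}{2q}}(2d)^{\frac1{2q}}}.$$ Put $$c_l=\frac{1}{(4dC_2\beta)^{\frac{2q-1}{2q}}}\left[\frac{C_1^2}{(4dC_2\beta)^{\frac1{2q}}}-\frac{2\sqrt{C_1C_2}\,\|g''\|_{L^q(\mathbb R)}}{2^{\frac1{2q}}}\right].$$ For even $N\ge 2$ let $T=(\mathbb Z/N\mathbb Z)^d$, with unit vectors $e_1,\dots,e_d$, and let $e_{-i}=-e_i$ and $I=\{-d,\dots,d\}\setminus\{0\}$. Let $T_{\rm ev}$,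 $T_{\rm od}$ be the sets of $x\in T$ with even, respectively odd, coordinate sum. For $u\in\mathbb R^d$ put $u_{-i}=-u_i$. With heights pinned by $\phi(0)=0$, define $$H(\phi,u)=\sum_{x\in T}\sum_{i=1}^d U(\phi(x+e_i)-\phi(x)+u_i),\qquad Z_T(u)=\int_{\mathbb R^{T\setminus\{0\}}}e^{-\beta H(\phi,u)}\prod_{x\in T\setminus\{0\}}d\phi(x),\qquad \sigma_T(u)=-\frac1{|T|}\log\frac{Z_T(u)}{Z_T(0)},$$ $$F_x\big((\phi(x+e_i))_{i\in I},u\big)=-\log\int_{\mathbb R}e^{-\beta\sum_{i\in I}U(\phi(x+e_i)-t+u_i)}\,dt,\qquad H_{\rm ev}(\phi,u)=\sum_{x\in T_{\rm od}}F_x\big((\phi(x+e_i))_{i\in I},u\big),$$ $$Z_{\rm ev}(u)=\int_{\mathbb R^{T_{\rm ev}\setminus\{0\}}}e^{-H_{\rm ev}(\phi,u)}\prod_{x\in T_{\rm ev}\setminus\{0\}}d\phi(x),\qquad \sigma_{\rm ev}(u)=-\frac1{|T_{\rm ev}|}\log\frac{Z_{\rm ev}(u)}{Z_{\rm ev}(0)}.$$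 Then $c_l>0$ and, for every even $N\ge 2$, the functions $\sigma_T$ and $\sigma_{\rm ev}$ are of class $C^2$ on $\mathbb R^d$ and $$D^2\sigma_T(u)=\tfrac12\,D^2\sigma_{\rm ev}(u)\ \ge\ 4d\beta^2c_l\,\mathrm{Id}\qquad\text{for all }u\in\mathbb R^d,$$ in the sense of quadratic forms. In particular both surface tensions are uniformly strictly convex, uniformly in $u$ and in even $N$. -/

import Mathlib

open MeasureTheory

namespace GradModel

/-- The discrete torus `(ℤ/Nℤ)^d`. -/
abbrev Torus (d N : ℕ) : Type := Fin d → ZMod N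

/-- The index set `I = {-d, …, -1, 1, …, d}`: `inl i` is the index of `e_i` and `inr i` is the
index of `e_{-i} = -e_i`. -/
abbrev Dir (d : ℕ) : Type := Fin d ⊕ Fin d

/-- The unit vector `e_i` of the torus, `i ∈ I`. -/
def unitVec (d N : ℕ) : Dir d → Torus d N
  | Sum.inl i => Pi.single i 1
  | Sum.inr i => -Pi.single i 1

/-- The component `u_i`, `i ∈ I`, of a tilt `u ∈ ℝ^d`, with `u_{-i} = -u_i`. -/
def tilt {d : ℕ} (u : EuclideanSpace ℝ (Fin d)) : Dir d → ℝ
  | Sum.inl i => u i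
  | Sum.inr i => -u i

/-- Even vertices of the torus. For even `N` (the only case in which it is used) the parity of the
residue class of `x_1 + … + x_d` modulo `N` is well defined, and a class is even if and only if
it is of the form `r + r`. -/
def IsEvenSite {d N : ℕ} (x : Torus d N) : Prop := Even (∑ i, x i)

instance {d N : ℕ} [NeZero N] : DecidablePred (IsEvenSite (d := d) (N := N)) :=
  fun x => inferInstanceAs (Decidable (∃ r : ZMod N, ∑ i, x i = r + r))

/-- The height configuration that equals `φ` on the sites satisfying `p` and `0` elsewhere. -/
def extendZero {X : Type} (p : X → Prop) [DecidablePred p] (φ : {x // p x} → ℝ) : X → ℝ :=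
  fun x => if h : p x then φ ⟨x, h⟩ else 0

/-- `H(φ, u) = ∑_x ∑_{i=1}^d U(∇_i φ(x) + u_i)`. -/
def torusHam {d N : ℕ} [NeZero N] (U : ℝ → ℝ) (φ : Torus d N → ℝ) (u : EuclideanSpace ℝ (Fin d)) : ℝ :=
  ∑ x : Torus d N, ∑ i : Fin d, U (φ (x + unitVec d N (Sum.inl i)) - φ x + u i)

/-- The partition function on the torus: the heights off the origin are integrated with respect to
Lebesgue measure, the height at the origin is pinned to `0`. -/
noncomputable def torusZ (d N : ℕ) [NeZero N] (β : ℝ) (U : ℝ → ℝ)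
    (u : EuclideanSpace ℝ (Fin d)) : ℝ :=
  ∫ φ : {x : Torus d N // x ≠ 0} → ℝ,
    Real.exp (-β * torusHam U (extendZero (fun x : Torus d N => x ≠ 0) φ) u)

/-- The surface tension on the torus. -/
noncomputable def torusSigma (d N : ℕ) [NeZero N] (β : ℝ) (U : ℝ → ℝ)
    (u : EuclideanSpace ℝ (Fin d)) : ℝ :=
  -(1 / (Fintype.card (Torus d N) : ℝ)) * Real.log (torusZ d N β U u / torusZ d N β U 0)

/-- `F((y_i)_{i ∈ I}, u) = -log ∫ exp(-β ∑_{i ∈ I} U(y_i - t + u_i)) dt`: the potential obtained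
by integrating out the height `t` of one odd vertex whose neighbours have the heights `y_i`. -/
noncomputable def oddPotential {d : ℕ} (β : ℝ) (U : ℝ → ℝ) (y : Dir d → ℝ)
    (u : EuclideanSpace ℝ (Fin d)) : ℝ :=
  -Real.log (∫ t : ℝ, Real.exp (-β * ∑ i : Dir d, U (y i - t + tilt u i)))

/-- The even Hamiltonian: the sum over odd `x` of `F((φ(x + e_i))_{i ∈ I}, u)`. For even `N` it
depends only on the heights at the even vertices. -/
noncomputable def evenHam {d N : ℕ} [NeZero N] (β : ℝ) (U : ℝ → ℝ) (φ : Torus d N → ℝ)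
    (u : EuclideanSpace ℝ (Fin d)) : ℝ :=
  ∑ x : Torus d N with ¬ IsEvenSite x, oddPotential β U (fun i => φ (x + unitVec d N i)) u

/-- The even partition function: the heights at the even vertices off the origin are integrated,
the height at the origin is pinned to `0`. The inverse temperature is contained in `evenHam`. -/
noncomputable def evenZ (d N : ℕ) [NeZero N] (β : ℝ) (U : ℝ → ℝ)
    (u : EuclideanSpace ℝ (Fin d)) : ℝ :=
  ∫ φ : {x : Torus d N // IsEvenSite x ∧ x ≠ 0} → ℝ,
    Real.exp (-evenHam β U (extendZero (fun x : Torus d N => IsEvenSite x ∧ x ≠ 0) φ) u)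

/-- The even surface tension. -/
noncomputable def evenSigma (d N : ℕ) [NeZero N] (β : ℝ) (U : ℝ → ℝ)
    (u : EuclideanSpace ℝ (Fin d)) : ℝ :=
  -(1 / (Fintype.card {x : Torus d N // IsEvenSite x} : ℝ)) *
    Real.log (evenZ d N β U u / evenZ d N β U 0)

/-- The second derivative, as a bilinear form. -/
noncomputable def hess {d : ℕ} (f : EuclideanSpace ℝ (Fin d) → ℝ)
    (u : EuclideanSpace ℝ (Fin d)) :
    EuclideanSpace ℝ (Fin d) →L[ℝ] EuclideanSpace ℝ (Fin d) →L[ℝ] ℝ :=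
  fderiv ℝ (fderiv ℝ f) u

/-- The `L^q(ℝ)` norm, for real `q`. Used only for functions in `L^q`. -/
noncomputable def lqNorm (q : ℝ) (f : ℝ → ℝ) : ℝ :=
  (eLpNorm f (ENNReal.ofReal q) volume).toReal

/-- The lower covariance bound `c_l`, where `G` stands for the `L^q` norm of `g''`. -/
noncomputable def covLower (d : ℕ) (β C₁ C₂ q G : ℝ) : ℝ :=
  1 / (4 * d * C₂ * β) ^ ((2 * q - 1) / (2 * q)) *
    (C₁ ^ 2 / (4 * d * C₂ * β) ^ (1 / (2 * q))
      - 2 * √(C₁ * C₂) * G / 2 ^ (1 / (2 * q)))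

end GradModel

/-! For even side the torus is bipartite: given the even heights, the odd heights are independent,
and each sees only its `2d` even neighbours. Integrating them out is Fubini, so the two partition
functions coincide (`torusZ_eq_evenZ`), and `|T| = 2|T_ev|` makes the even surface tension twice the
other one. What remains is a lower bound for the second differences of `σ_T`. The potential `U` need
not be convex, but integrating out a site produces a potential that is convex modulo constants.

One site. Let `F(z) = -log ∫ exp(-β ∑ U(z_k - t)) dt`. Integration by parts in `t` shows that the
rows of the Hessian of `F` sum to zero, hence `D²F(w,w) = (β²/2) ∑_{i,j} (w_i - w_j)² Cov(U'(z_i -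
t), U'(z_j - t))`. A covariance is half the mean of a product of increments over two independent
copies `s, t`. The increments of `V'` have slope in `[C₁, C₂]`; those of `g'` are of the opposite
sign and, by Hölder, at most `‖g''‖_q δ^(1-1/q)` in size. The product may be negative for small `δ =
|s - t|`, yet it dominates an affine function of `δ²`, namely `k(δ² - 2/a) + 4c_l` with `k ≥ 0` and
`a = 2dC₂β` (`increment_mul_lower`). The one-site potential has second derivative at most `a`, so
its variance is at least `1/a` (`variance_siteWeight_ge`), the mean of `δ²` is at least `2/a`, and
every covariance is at least `2c_l`. This gives `siteFree_second_difference_ge`.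

Whole torus. Moving the heights by `ψ` and the tilt by `v` moves the data of an odd site by `w_i =
ψ(x + e_i) + v_i`. In `∑_{i,j} (w_i - w_j)²` the terms mixing `ψ` and `v` cancel after summation
over odd sites, so the even Hamiltonian gains `8dβ²c_l |T_od| |v|²` whatever `ψ` is. The midpoint
Prékopa–Leindler inequality passes this joint convexity on to `-log Z_ev` (`evenZ_mul_evenZ_le`),
and division by `|T| = 2|T_od|` leaves `4dβ²c_l |v|²`. Quadratic growth of `U` and a discrete
Poincaré inequality justify differentiation under the integral, so `σ_T` is `C²` and the second
differences bound its Hessian. -/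

open scoped ENNReal

/-! ### Brunn–Minkowski and Prékopa–Leindler inequalities at the midpoint -/

/-- One-dimensional Brunn–Minkowski inequality for compact sets, in midpoint form. -/
theorem volume_add_le_of_midpoint_mem_of_isCompact {A B C : Set ℝ} (hA : IsCompact A)
    (hB : IsCompact B) (hA0 : A.Nonempty) (hB0 : B.Nonempty)
    (h : ∀ a ∈ A, ∀ b ∈ B, (a + b) / 2 ∈ C) :
    volume A + volume B ≤ 2 * volume C := by
  obtain ⟨α, hαA, hα⟩ := hA.exists_isGreatest hA0
  obtain ⟨b, hbB, hb⟩ := hB.exists_isLeast hB0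
  have half : ∀ (c : ℝ) (S : Set ℝ), volume ((fun x : ℝ => 2 * x + c) ⁻¹' S) = 2⁻¹ * volume S := by
    intro c S
    have h1 : (fun x : ℝ => 2 * x + c) ⁻¹' S = (2 * ·) ⁻¹' ((· + c) ⁻¹' S) := rfl
    rw [h1, Real.volume_preimage_mul_left (by norm_num), measure_preimage_add_right]
    congr 1
    rw [abs_of_pos (by norm_num), ENNReal.ofReal_inv_of_pos (by norm_num)]
    norm_num
  -- The half-size copies `(A + b)/2` and `(α + B)/2` both lie in `C`; as `α` is the maximum of `A`
  -- and `b` the minimum of `B`, they can meet only at `(α + b)/2`.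
  have hA' : (fun x : ℝ => 2 * x + (-b)) ⁻¹' A ⊆ C ∩ Set.Iic ((α + b) / 2) := by
    intro x hx
    have h1 := h _ hx _ hbB
    have h2 := hα hx
    refine ⟨by convert h1 using 1; ring, ?_⟩
    simp only [Set.mem_Iic]; linarith
  have hB' : (fun x : ℝ => 2 * x + (-α)) ⁻¹' B ⊆ C ∩ Set.Ici ((α + b) / 2) := by
    intro x hx
    have h1 := h _ hαA _ hx
    have h2 := hb hx
    refine ⟨by convert h1 using 1; ring, ?_⟩
    simp only [Set.mem_Ici]; linarith
  have hC : volume (C ∩ Set.Iic ((α + b) / 2)) + volume (C ∩ Set.Ici ((α + b) / 2)) = volume C := by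
    have e : volume (C ∩ Set.Ici ((α + b) / 2)) = volume (C \ Set.Iic ((α + b) / 2)) := by
      apply measure_congr
      have : (C \ Set.Iic ((α + b) / 2)) = C ∩ Set.Ioi ((α + b) / 2) := by
        ext x; simp
      rw [this]
      exact (Filter.EventuallyEq.refl _ C).inter Ioi_ae_eq_Ici.symm
    rw [e, measure_inter_add_sdiff _ measurableSet_Iic]
  have := add_le_add (measure_mono (μ := volume) hA') (measure_mono (μ := volume) hB')
  rw [half, half, hC, ← mul_add] at this
  calc volume A + volume B = 2 * (2⁻¹ * (volume A + volume B)) := by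
        rw [← mul_assoc, ENNReal.mul_inv_cancel (by norm_num) (by norm_num), one_mul]
    _ ≤ _ := by gcongr

/-- One-dimensional Brunn–Minkowski inequality, in midpoint form. -/
theorem volume_add_le_of_midpoint_mem {A B C : Set ℝ} (hA : MeasurableSet A)
    (hB : MeasurableSet B) (hA0 : A.Nonempty) (hB0 : B.Nonempty)
    (h : ∀ a ∈ A, ∀ b ∈ B, (a + b) / 2 ∈ C) :
    volume A + volume B ≤ 2 * volume C := by
  obtain ⟨a, ha⟩ := hA0
  obtain ⟨b, hb⟩ := hB0
  rw [hA.measure_eq_iSup_isCompact, hB.measure_eq_iSup_isCompact]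
  have key : ∀ K, (K ⊆ A ∧ IsCompact K) → ∀ L, (L ⊆ B ∧ IsCompact L) →
      volume K + volume L ≤ 2 * volume C := by
    rintro K ⟨hKA, hK⟩ L ⟨hLB, hL⟩
    -- The compact approximations may be empty; adjoining fixed points of `A` and `B` makes them
    -- nonempty.
    have := volume_add_le_of_midpoint_mem_of_isCompact (hK.insert a) (hL.insert b)
      (Set.insert_nonempty _ _) (Set.insert_nonempty _ _) (C := C) (by
        intro a' ha' b' hb'
        exact h a' (Set.insert_subset ha hKA ha') b' (Set.insert_subset hb hLB hb'))
    exact le_trans (add_le_add (measure_mono (Set.subset_insert _ _))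
      (measure_mono (Set.subset_insert _ _))) this
  have := ENNReal.biSup_add_biSup_le' (p := fun K => K ⊆ A ∧ IsCompact K)
    (q := fun K => K ⊆ B ∧ IsCompact K) (f := fun K => volume K) (g := fun K => volume K)
    ⟨∅, by simp⟩ ⟨∅, by simp⟩ key
  simpa [iSup_and] using this

/-- Additive form of the one-dimensional Prékopa–Leindler inequality for functions with
supremum `1`. -/
theorem lintegral_add_le_of_midpoint {f g h : ℝ → ℝ} (hf : Measurable f) (hg : Measurable g)
    (hh : Measurable h) (hf0 : ∀ x, 0 ≤ f x) (hg0 : ∀ x, 0 ≤ g x) (hh0 : ∀ x, 0 ≤ h x)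
    (hf1 : ∀ x, f x ≤ 1) (hg1 : ∀ x, g x ≤ 1)
    (hfs : ∀ t < 1, ∃ x, t < f x) (hgs : ∀ t < 1, ∃ x, t < g x)
    (H : ∀ x y t, 0 ≤ t → t < f x → t < g y → t < h ((x + y) / 2)) :
    (∫⁻ x, ENNReal.ofReal (f x)) + ∫⁻ x, ENNReal.ofReal (g x) ≤
      2 * ∫⁻ x, ENNReal.ofReal (h x) := by
  have hmeas : ∀ {f : ℝ → ℝ}, Measurable fun t => volume {a : ℝ | t < f a} := fun {f} =>
    (Antitone.measurable fun s t hst => measure_mono fun a (ha : t < f a) => hst.trans_lt ha)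
  rw [lintegral_eq_lintegral_meas_lt volume (.of_forall hf0) hf.aemeasurable,
    lintegral_eq_lintegral_meas_lt volume (.of_forall hg0) hg.aemeasurable,
    lintegral_eq_lintegral_meas_lt volume (.of_forall hh0) hh.aemeasurable,
    ← lintegral_add_left hmeas, ← lintegral_const_mul _ hmeas]
  refine setLIntegral_mono' measurableSet_Ioi fun t ht => ?_
  -- Brunn–Minkowski fails for an empty set; supremum `1` for both functions makes their superlevel
  -- sets become empty at the same level.
  rcases lt_or_ge t 1 with h1 | h1
  · exact volume_add_le_of_midpoint_mem (hf measurableSet_Ioi) (hg measurableSet_Ioi)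
      (hfs t h1) (hgs t h1) fun a ha b hb => H a b t (le_of_lt ht) ha hb
  · have e1 : {a | t < f a} = ∅ := by
      ext a; simpa using (hf1 a).trans h1
    have e2 : {a | t < g a} = ∅ := by
      ext a; simpa using (hg1 a).trans h1
    simp [e1, e2]

theorem ENNReal.four_mul_le_sq_add (x y : ℝ≥0∞) : 4 * (x * y) ≤ (x + y) ^ 2 := by
  rcases eq_or_ne x ⊤ with rfl | hx
  · simp
  rcases eq_or_ne y ⊤ with rfl | hy
  · simp
  lift x to NNReal using hx
  lift y to NNReal using hy
  norm_cast
  rw [← mul_assoc]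
  exact _root_.four_mul_le_sq_add x y

/-- The Prékopa–Leindler inequality on the line, at the midpoint, for bounded functions. -/
theorem lintegral_mul_lintegral_le_sq_of_bounded {f g h : ℝ → ℝ≥0∞} (hf : Measurable f)
    (hg : Measurable g) (hh : Measurable h) {M : ℝ≥0∞} (hM : M ≠ ⊤) (hfM : ∀ x, f x ≤ M)
    (hgM : ∀ x, g x ≤ M) (H : ∀ x y, f x * g y ≤ h ((x + y) / 2) ^ 2) :
    (∫⁻ x, f x) * ∫⁻ x, g x ≤ (∫⁻ x, h x) ^ 2 := by
  set a := ⨆ x, f x with ha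
  set b := ⨆ x, g x with hb
  have haT : a ≠ ⊤ := ne_top_of_le_ne_top hM (iSup_le hfM)
  have hbT : b ≠ ⊤ := ne_top_of_le_ne_top hM (iSup_le hgM)
  rcases eq_or_ne a 0 with ha0 | ha0
  · have : ∀ x, f x = 0 := fun x => le_antisymm (ha0 ▸ le_iSup f x) (by simp)
    simp [this]
  rcases eq_or_ne b 0 with hb0 | hb0
  · have : ∀ x, g x = 0 := fun x => le_antisymm (hb0 ▸ le_iSup g x) (by simp)
    simp [this]
  set r := (a * b) ^ (1 / 2 : ℝ) with hr
  have hrr : r ^ 2 = a * b := by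
    rw [hr, ← ENNReal.rpow_natCast, ← ENNReal.rpow_mul]; norm_num
  have hr0 : r ≠ 0 := by
    intro h0; rw [h0] at hrr; simp at hrr; tauto
  have hrT : r ≠ ⊤ := by
    intro h0; rw [h0] at hrr; simp at hrr; exact ENNReal.mul_ne_top haT hbT hrr.symm
  have hfa : ∀ x, f x / a ≤ 1 := fun x => ENNReal.div_le_of_le_mul (by simpa using le_iSup f x)
  have hgb : ∀ x, g x / b ≤ 1 := fun x => ENNReal.div_le_of_le_mul (by simpa using le_iSup g x)
  have hlt : ∀ {f : ℝ → ℝ≥0∞} {a : ℝ≥0∞} {x t : ℝ}, a ≠ 0 → a ≠ ⊤ → f x / a ≤ 1 → 0 ≤ t →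
      (t < (f x / a).toReal ↔ ENNReal.ofReal t * a < f x) := by
    intro f a x t ha0 haT h1 ht
    rw [← ENNReal.ofReal_lt_iff_lt_toReal ht (ne_top_of_le_ne_top (by simp) h1),
      ENNReal.lt_div_iff_mul_lt (Or.inl ha0) (Or.inl haT)]
  have hsup : ∀ {f : ℝ → ℝ≥0∞}, (⨆ x, f x) ≠ 0 → (⨆ x, f x) ≠ ⊤ → ∀ t < 1, ∃ x,
      t < (f x / ⨆ x, f x).toReal := by
    intro f ha0 haT t ht
    rcases lt_or_ge t 0 with h0 | h0
    · exact ⟨0, h0.trans_le ENNReal.toReal_nonneg⟩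
    have : ENNReal.ofReal t * (⨆ x, f x) < ⨆ x, f x := by
      conv_rhs => rw [← one_mul (⨆ x, f x)]
      exact ENNReal.mul_lt_mul_left ha0 haT (by simpa using ht)
    obtain ⟨x, hx⟩ := lt_iSup_iff.1 this
    exact ⟨x, (hlt ha0 haT (ENNReal.div_le_of_le_mul (by simpa using le_iSup f x)) h0).2 hx⟩
  -- Since `h` may be infinite, `h / r` is capped at `1` before passing to real values; only levels
  -- below `1` occur on the left, so nothing is lost.
  have key := lintegral_add_le_of_midpoint (f := fun x => (f x / a).toReal)
    (g := fun x => (g x / b).toReal) (h := fun x => (min (h x / r) 1).toReal)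
    (by fun_prop) (by fun_prop) (by fun_prop) (fun _ => ENNReal.toReal_nonneg)
    (fun _ => ENNReal.toReal_nonneg) (fun _ => ENNReal.toReal_nonneg)
    (fun x => ENNReal.toReal_le_of_le_ofReal zero_le_one (by simpa using hfa x))
    (fun x => ENNReal.toReal_le_of_le_ofReal zero_le_one (by simpa using hgb x))
    (hsup ha0 haT) (hsup hb0 hbT) (by
      intro x y t ht hx hy
      have ht1 : t < 1 := hx.trans_le
        (ENNReal.toReal_le_of_le_ofReal zero_le_one (by simpa using hfa x))
      have hx' := (hlt ha0 haT (hfa x) ht).1 hx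
      have hy' := (hlt hb0 hbT (hgb y) ht).1 hy
      rw [← ENNReal.ofReal_lt_iff_lt_toReal ht (ne_top_of_le_ne_top (by simp) (min_le_right _ 1)),
        lt_min_iff]
      refine ⟨?_, by simpa using ht1⟩
      rw [ENNReal.lt_div_iff_mul_lt (Or.inl hr0) (Or.inl hrT)]
      refine lt_of_pow_lt_pow_left' 2 ?_
      calc (ENNReal.ofReal t * r) ^ 2 = (ENNReal.ofReal t * a) * (ENNReal.ofReal t * b) := by
            rw [mul_pow, hrr]; ring
        _ < f x * g y := ENNReal.mul_lt_mul hx' hy'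
        _ ≤ _ := H x y)
  have e1 : ∀ x, ENNReal.ofReal (f x / a).toReal = a⁻¹ * f x := fun x => by
    rw [ENNReal.ofReal_toReal (ne_top_of_le_ne_top (by simp) (hfa x)), mul_comm, div_eq_mul_inv]
  have e2 : ∀ x, ENNReal.ofReal (g x / b).toReal = b⁻¹ * g x := fun x => by
    rw [ENNReal.ofReal_toReal (ne_top_of_le_ne_top (by simp) (hgb x)), mul_comm, div_eq_mul_inv]
  have e3 : ∀ x, ENNReal.ofReal (min (h x / r) 1).toReal ≤ r⁻¹ * h x := fun x => by
    rw [ENNReal.ofReal_toReal (ne_top_of_le_ne_top (by simp) (min_le_right _ 1)), mul_comm,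
      ← div_eq_mul_inv]
    exact min_le_left _ _
  simp only [e1, e2] at key
  rw [lintegral_const_mul _ hf, lintegral_const_mul _ hg] at key
  have key2 := key.trans (mul_le_mul_right (lintegral_mono e3) 2)
  rw [lintegral_const_mul _ hh] at key2
  -- AM–GM turns the additive inequality for the normalised functions into the multiplicative one.
  have h4 := (ENNReal.four_mul_le_sq_add _ _).trans (pow_le_pow_left' key2 2)
  set F := ∫⁻ x, f x
  set G := ∫⁻ x, g x
  set I := ∫⁻ x, h x
  have h5 : 4 * (F * G) ≤ 4 * I ^ 2 := by
    calc 4 * (F * G) = (a * b) * (4 * (a⁻¹ * F * (b⁻¹ * G))) := by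
          rw [show (a * b) * (4 * (a⁻¹ * F * (b⁻¹ * G))) = (a * a⁻¹) * (b * b⁻¹) * (4 * (F * G)) by
            ring, ENNReal.mul_inv_cancel ha0 haT, ENNReal.mul_inv_cancel hb0 hbT]
          ring
      _ ≤ (a * b) * (2 * (r⁻¹ * I)) ^ 2 := by gcongr
      _ = 4 * I ^ 2 := by
          rw [← hrr, show r ^ 2 * (2 * (r⁻¹ * I)) ^ 2 = (r * r⁻¹) ^ 2 * (2 ^ 2 * I ^ 2) by ring,
            ENNReal.mul_inv_cancel hr0 hrT]
          norm_num
  exact (ENNReal.mul_le_mul_iff_right (by norm_num) (by norm_num)).1 h5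

/-- The Prékopa–Leindler inequality on the line, at the midpoint. -/
theorem lintegral_mul_lintegral_le_sq {f g h : ℝ → ℝ≥0∞} (hf : Measurable f)
    (hg : Measurable g) (hh : Measurable h) (H : ∀ x y, f x * g y ≤ h ((x + y) / 2) ^ 2) :
    (∫⁻ x, f x) * ∫⁻ x, g x ≤ (∫⁻ x, h x) ^ 2 := by
  have trunc : ∀ {f : ℝ → ℝ≥0∞}, Measurable f → ∫⁻ x, f x = ⨆ n : ℕ, ∫⁻ x, min (f x) n := by
    intro f hf
    rw [← lintegral_iSup (f := fun (n : ℕ) x => min (f x) (n : ℝ≥0∞))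
      (fun n => hf.min measurable_const)
      (fun m n hmn x => min_le_min_left _ (by exact_mod_cast hmn))]
    congr 1
    ext x
    rw [← inf_iSup_eq, ENNReal.iSup_natCast, inf_top_eq]
  rw [trunc hf, trunc hg, ENNReal.iSup_mul]
  refine iSup_le fun m => ?_
  rw [ENNReal.mul_iSup]
  refine iSup_le fun n => ?_
  refine lintegral_mul_lintegral_le_sq_of_bounded (M := max m n) (hf.min measurable_const)
    (hg.min measurable_const) hh
    (by simp) (fun x => (min_le_right _ _).trans (le_max_left _ _))
    (fun x => (min_le_right _ _).trans (le_max_right _ _)) fun x y => le_trans ?_ (H x y)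
  gcongr <;> exact min_le_left _ _

/-- The Prékopa–Leindler inequality, at the midpoint, for iterated integrals. -/
theorem lmarginal_mul_lmarginal_le_sq {ι : Type*} [DecidableEq ι] (s : Finset ι) :
    ∀ {f g h : (ι → ℝ) → ℝ≥0∞}, Measurable f → Measurable g → Measurable h →
    (∀ x y, f x * g y ≤ h (fun i => (x i + y i) / 2) ^ 2) → ∀ x y,
    lmarginal (fun _ => volume) s f x * lmarginal (fun _ => volume) s g y ≤
      lmarginal (fun _ => volume) s h (fun i => (x i + y i) / 2) ^ 2 := by
  induction s using Finset.induction_on with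
  | empty => intro f g h _ _ _ H x y; simpa using H x y
  | insert i s hi ih =>
    intro f g h hf hg hh H x y
    rw [lmarginal_insert _ hf hi, lmarginal_insert _ hg hi, lmarginal_insert _ hh hi]
    refine lintegral_mul_lintegral_le_sq
      ((hf.lmarginal _).comp (measurable_update _)) ((hg.lmarginal _).comp (measurable_update _))
      ((hh.lmarginal _).comp (measurable_update _)) fun a b => ?_
    have e : Function.update (fun i => (x i + y i) / 2) i ((a + b) / 2) = fun j =>
        (Function.update x i a j + Function.update y i b j) / 2 := by
      funext j
      rcases eq_or_ne j i with rfl | hj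
      · simp
      · simp [hj]
    rw [e]
    exact ih hf hg hh H _ _

/-- The Prékopa–Leindler inequality, at the midpoint. -/
theorem lintegral_pi_mul_lintegral_pi_le_sq {ι : Type*} [Fintype ι] {f g h : (ι → ℝ) → ℝ≥0∞}
    (hf : Measurable f) (hg : Measurable g) (hh : Measurable h)
    (H : ∀ x y, f x * g y ≤ h (fun i => (x i + y i) / 2) ^ 2) :
    (∫⁻ x, f x) * ∫⁻ x, g x ≤ (∫⁻ x, h x) ^ 2 := by
  classical
  have := lmarginal_mul_lmarginal_le_sq Finset.univ hf hg hh H 0 0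
  simpa [lmarginal_univ, volume_pi] using this

/-! ### Gradient potentials and Gaussian moment bounds -/

/-- A `C²` potential with derivatives `U₁`, `U₂`, bounded second derivative and quadratic growth. -/
structure IsGradPotential (U U₁ U₂ : ℝ → ℝ) (A B M : ℝ) : Prop where
  deriv_one : ∀ s, HasDerivAt U (U₁ s) s
  deriv_two : ∀ s, HasDerivAt U₁ (U₂ s) s
  cont_two : Continuous U₂
  bound : ∀ s, |U₂ s| ≤ M
  pos : 0 < A
  lower : ∀ s, A * s ^ 2 - B ≤ U s

namespace IsGradPotential

variable {U U₁ U₂ : ℝ → ℝ} {A B M : ℝ}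

theorem cont_one (h : IsGradPotential U U₁ U₂ A B M) : Continuous U₁ :=
  continuous_iff_continuousAt.2 fun s => (h.deriv_two s).continuousAt

theorem cont (h : IsGradPotential U U₁ U₂ A B M) : Continuous U :=
  continuous_iff_continuousAt.2 fun s => (h.deriv_one s).continuousAt

theorem bound_nonneg (h : IsGradPotential U U₁ U₂ A B M) : 0 ≤ M :=
  (abs_nonneg _).trans (h.bound 0)

theorem abs_one_le (h : IsGradPotential U U₁ U₂ A B M) (s : ℝ) :
    |U₁ s| ≤ (|U₁ 0| + M) * (1 + |s|) := by
  have h1 : |U₁ s - U₁ 0| ≤ M * |s - 0| :=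
    convex_univ.norm_image_sub_le_of_norm_hasDerivWithin_le
      (fun x _ => (h.deriv_two x).hasDerivWithinAt) (fun x _ => h.bound x)
      (Set.mem_univ _) (Set.mem_univ _)
  rw [sub_zero] at h1
  have h2 := abs_sub_abs_le_abs_sub (U₁ s) (U₁ 0)
  nlinarith [h.bound_nonneg, abs_nonneg s, abs_nonneg (U₁ 0), mul_nonneg (abs_nonneg (U₁ 0)) (abs_nonneg s)]

theorem abs_one_sub_le (h : IsGradPotential U U₁ U₂ A B M) (z : ℝ) :
    ∃ C, 0 ≤ C ∧ ∀ t, |U₁ (z - t)| ≤ C * (1 + |t|) := by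
  refine ⟨(|U₁ 0| + M) * (1 + |z|), mul_nonneg (add_nonneg (abs_nonneg _) h.bound_nonneg)
    (by positivity), fun t => (h.abs_one_le _).trans ?_⟩
  rw [mul_assoc]
  refine mul_le_mul_of_nonneg_left ?_ (add_nonneg (abs_nonneg _) h.bound_nonneg)
  nlinarith [abs_sub z t, abs_nonneg z, abs_nonneg t, mul_nonneg (abs_nonneg z) (abs_nonneg t)]

end IsGradPotential

/-- Follows from `y ^ k / k! ≤ exp y` at `y = γ(1 + r²)`, after replacing `(1 + r)` by `2(1 + r²)`.
-/
theorem one_add_pow_mul_exp_neg_le {γ : ℝ} (hγ : 0 < γ) (k : ℕ) {r : ℝ} (hr : 0 ≤ r) :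
    (1 + r) ^ k * Real.exp (-γ * r ^ 2) ≤ 2 ^ k * k.factorial / γ ^ k * Real.exp γ := by
  have h1 : (1 + r) ^ k ≤ 2 ^ k * (1 + r ^ 2) ^ k := by
    rw [← mul_pow]
    exact pow_le_pow_left₀ (by positivity) (by nlinarith [sq_nonneg (r - 1)]) k
  have h2 := Real.pow_div_factorial_le_exp (γ * (1 + r ^ 2)) (by positivity) k
  rw [div_le_iff₀ (by positivity), mul_pow] at h2
  have h3 : (1 + r ^ 2) ^ k ≤ k.factorial / γ ^ k * Real.exp (γ * (1 + r ^ 2)) := by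
    rw [div_mul_eq_mul_div, le_div_iff₀ (by positivity)]
    linarith
  have h4 : Real.exp (γ * (1 + r ^ 2)) * Real.exp (-γ * r ^ 2) = Real.exp γ := by
    rw [← Real.exp_add]; ring_nf
  calc (1 + r) ^ k * Real.exp (-γ * r ^ 2)
      ≤ 2 ^ k * (k.factorial / γ ^ k * Real.exp (γ * (1 + r ^ 2))) * Real.exp (-γ * r ^ 2) := by
        gcongr; exact h1.trans (by gcongr)
    _ = 2 ^ k * k.factorial / γ ^ k * (Real.exp (γ * (1 + r ^ 2)) * Real.exp (-γ * r ^ 2)) := by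
        ring
    _ = _ := by rw [h4]

theorem integrable_one_add_norm_sq_mul_exp {X : Type*} [NormedAddCommGroup X] [NormedSpace ℝ X]
    [FiniteDimensional ℝ X] [MeasurableSpace X] [BorelSpace X] (μ : Measure X)
    [μ.IsAddHaarMeasure] {γ : ℝ} (hγ : 0 < γ) :
    Integrable (fun x : X => (1 + ‖x‖) ^ 2 * Real.exp (-γ * ‖x‖ ^ 2)) μ := by
  -- One more than the dimension, so that `(1 + ‖x‖) ^ (-p)` is integrable.
  set p := Module.finrank ℝ X + 1
  have hp : (Module.finrank ℝ X : ℝ) < p := by simp [p]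
  refine ((integrable_one_add_norm (μ := μ) hp).const_mul
    (2 ^ (2 + p) * (2 + p).factorial / γ ^ (2 + p) * Real.exp γ)).mono'
    (Continuous.aestronglyMeasurable (((continuous_const.add continuous_norm).pow 2).mul
      (Real.continuous_exp.comp (continuous_const.mul (continuous_norm.pow 2))))) (.of_forall fun x => ?_)
  rw [Real.norm_of_nonneg (by positivity), Real.rpow_neg (by positivity), Real.rpow_natCast,
    ← div_eq_mul_inv, le_div_iff₀ (by positivity)]
  calc _ = (1 + ‖x‖) ^ (2 + p) * Real.exp (-γ * ‖x‖ ^ 2) := by rw [pow_add]; ring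
    _ ≤ _ := one_add_pow_mul_exp_neg_le hγ _ (norm_nonneg x)

/-! ### Differentiation under the integral sign -/

section Parametric

variable {E X G : Type*} [NormedAddCommGroup E] [NormedSpace ℝ E]
  [NormedAddCommGroup G] [NormedSpace ℝ G] [MeasurableSpace X] {μ : Measure X}

/-- Differentiation under the integral sign with locally uniform domination. -/
theorem hasFDerivAt_integral_of_locally_dominated {F : E → X → G} {F' : E → X → E →L[ℝ] G}
    (hF : ∀ u, AEStronglyMeasurable (F u) μ) (hF' : ∀ u, AEStronglyMeasurable (F' u) μ)
    (hb : ∀ R : ℝ, ∃ b : X → ℝ, Integrable b μ ∧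
      ∀ u, ‖u‖ < R → ∀ x, ‖F u x‖ ≤ b x ∧ ‖F' u x‖ ≤ b x)
    (hd : ∀ u x, HasFDerivAt (F · x) (F' u x) u) (u : E) :
    HasFDerivAt (fun u => ∫ x, F u x ∂μ) (∫ x, F' u x ∂μ) u := by
  obtain ⟨b, hbi, hb⟩ := hb (‖u‖ + 1)
  have hs : {v : E | ‖v‖ < ‖u‖ + 1} ∈ nhds u :=
    (isOpen_lt continuous_norm continuous_const).mem_nhds (by simp)
  exact hasFDerivAt_integral_of_dominated_of_fderiv_le hs (.of_forall hF)
    (hbi.mono' (hF u) (.of_forall fun x => (hb u (by simp) x).1)) (hF' u)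
    (.of_forall fun x v hv => (hb v hv x).2) hbi (.of_forall fun x v _ => hd v x)

theorem continuous_integral_of_locally_dominated {E X G : Type*} [NormedAddCommGroup E]
    [NormedAddCommGroup G] [NormedSpace ℝ G] [MeasurableSpace X] {μ : Measure X} {F : E → X → G}
    (hF : ∀ u, AEStronglyMeasurable (F u) μ)
    (hb : ∀ R : ℝ, ∃ b : X → ℝ, Integrable b μ ∧ ∀ u, ‖u‖ < R → ∀ x, ‖F u x‖ ≤ b x)
    (hc : ∀ x, Continuous (F · x)) : Continuous fun u => ∫ x, F u x ∂μ := by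
  refine continuous_iff_continuousAt.2 fun u => ?_
  obtain ⟨b, hbi, hb⟩ := hb (‖u‖ + 1)
  have hs : {v : E | ‖v‖ < ‖u‖ + 1} ∈ nhds u :=
    (isOpen_lt continuous_norm continuous_const).mem_nhds (by simp)
  refine continuousAt_of_dominated (.of_forall hF) ?_ hbi
    (.of_forall fun x => (hc x).continuousAt)
  filter_upwards [hs] with v hv using .of_forall fun x => hb v hv x

end Parametric

/-! ### Smoothness of Gibbs partition functions in a linear parameter (used for one site and for the
torus) -/

section Gibbs

set_option maxSynthPendingDepth 3

variable {E X K : Type*} [NormedAddCommGroup E] [NormedSpace ℝ E]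
  [NormedAddCommGroup X] [NormedSpace ℝ X] [Fintype K]

/-- The Boltzmann weight `exp (-β ∑ₖ U (ℓₖ u + mₖ φ))`. -/
noncomputable def gibbsWeight (β : ℝ) (U : ℝ → ℝ) (ℓ : K → E →L[ℝ] ℝ) (m : K → X →L[ℝ] ℝ)
    (u : E) (φ : X) : ℝ :=
  Real.exp (-β * ∑ k, U (ℓ k u + m k φ))

/-- The logarithmic derivative of the Boltzmann weight in the parameter. -/
noncomputable def gibbsScore (β : ℝ) (U₁ : ℝ → ℝ) (ℓ : K → E →L[ℝ] ℝ) (m : K → X →L[ℝ] ℝ)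
    (u : E) (φ : X) : E →L[ℝ] ℝ :=
  (-β) • ∑ k, U₁ (ℓ k u + m k φ) • ℓ k

/-- The derivative of the score in the parameter. -/
noncomputable def gibbsScoreDeriv (β : ℝ) (U₂ : ℝ → ℝ) (ℓ : K → E →L[ℝ] ℝ)
    (m : K → X →L[ℝ] ℝ) (u : E) (φ : X) : E →L[ℝ] E →L[ℝ] ℝ :=
  (-β) • ∑ k, (U₂ (ℓ k u + m k φ) • ℓ k).smulRight (ℓ k)

/-- The second derivative of the Boltzmann weight in the parameter. -/
noncomputable def gibbsSecond (β : ℝ) (U U₁ U₂ : ℝ → ℝ) (ℓ : K → E →L[ℝ] ℝ)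
    (m : K → X →L[ℝ] ℝ) (u : E) (φ : X) : E →L[ℝ] E →L[ℝ] ℝ :=
  gibbsWeight β U ℓ m u φ • gibbsScoreDeriv β U₂ ℓ m u φ +
    (gibbsWeight β U ℓ m u φ • gibbsScore β U₁ ℓ m u φ).smulRight
      (gibbsScore β U₁ ℓ m u φ)

variable {β A B M c : ℝ} {U U₁ U₂ : ℝ → ℝ} {ℓ : K → E →L[ℝ] ℝ} {m : K → X →L[ℝ] ℝ}

theorem hasFDerivAt_gibbsWeight (h : IsGradPotential U U₁ U₂ A B M) (u : E) (φ : X) :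
    HasFDerivAt (gibbsWeight β U ℓ m · φ)
      (gibbsWeight β U ℓ m u φ • gibbsScore β U₁ ℓ m u φ) u := by
  refine HasFDerivAt.exp (HasFDerivAt.const_mul (HasFDerivAt.fun_sum fun k _ => ?_) (-β))
  exact (h.deriv_one _).comp_hasFDerivAt u ((ℓ k).hasFDerivAt.add_const _)

theorem hasFDerivAt_gibbsScore (h : IsGradPotential U U₁ U₂ A B M) (u : E) (φ : X) :
    HasFDerivAt (gibbsScore β U₁ ℓ m · φ) (gibbsScoreDeriv β U₂ ℓ m u φ) u := by
  refine HasFDerivAt.const_smul (HasFDerivAt.fun_sum fun k _ => ?_) (-β)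
  exact ((h.deriv_two _).comp_hasFDerivAt u ((ℓ k).hasFDerivAt.add_const _)).smul_const (ℓ k)

theorem continuous_gibbsWeight (h : IsGradPotential U U₁ U₂ A B M) :
    Continuous fun p : E × X => gibbsWeight β U ℓ m p.1 p.2 := by
  have := h.cont
  have hk : ∀ k, Continuous fun p : E × X => U (ℓ k p.1 + m k p.2) := fun k =>
    this.comp (((ℓ k).continuous.comp continuous_fst).add ((m k).continuous.comp continuous_snd))
  exact Real.continuous_exp.comp (continuous_const.mul (continuous_finsetSum _ fun k _ => hk k))

theorem continuous_gibbsScore (h : IsGradPotential U U₁ U₂ A B M) :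
    Continuous fun p : E × X => gibbsScore β U₁ ℓ m p.1 p.2 := by
  have := h.cont_one
  have hk : ∀ k, Continuous fun p : E × X => U₁ (ℓ k p.1 + m k p.2) := fun k =>
    this.comp (((ℓ k).continuous.comp continuous_fst).add ((m k).continuous.comp continuous_snd))
  exact (continuous_finsetSum _ fun k _ => (hk k).smul continuous_const).const_smul (-β)

theorem continuous_gibbsScoreDeriv (h : IsGradPotential U U₁ U₂ A B M) :
    Continuous fun p : E × X => gibbsScoreDeriv β U₂ ℓ m p.1 p.2 := by
  have := h.cont_two
  have e : ∀ p : E × X, gibbsScoreDeriv β U₂ ℓ m p.1 p.2 =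
      (-β) • ∑ k, U₂ (ℓ k p.1 + m k p.2) • (ℓ k).smulRight (ℓ k) := by
    intro p
    unfold gibbsScoreDeriv
    congr 1
    refine Finset.sum_congr rfl fun k _ => ?_
    ext x y
    simp [mul_assoc]
  simp_rw [e]
  have hk : ∀ k, Continuous fun p : E × X => U₂ (ℓ k p.1 + m k p.2) := fun k =>
    this.comp (((ℓ k).continuous.comp continuous_fst).add ((m k).continuous.comp continuous_snd))
  exact (continuous_finsetSum _ fun k _ => (hk k).smul continuous_const).const_smul (-β)

theorem norm_gibbsScore_le (h : IsGradPotential U U₁ U₂ A B M) (R : ℝ) :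
    ∃ C, 0 ≤ C ∧ ∀ u : E, ‖u‖ < R → ∀ φ : X, ‖gibbsScore β U₁ ℓ m u φ‖ ≤ C * (1 + ‖φ‖) := by
  refine ⟨|β| * ∑ k, (|U₁ 0| + M) * (1 + ‖ℓ k‖ * |R| + ‖m k‖) * ‖ℓ k‖,
    mul_nonneg (abs_nonneg _) (Finset.sum_nonneg fun k _ => ?_), fun u hu φ => ?_⟩
  · have := h.bound_nonneg
    positivity
  have hM := h.bound_nonneg
  rw [gibbsScore, norm_smul, norm_neg, Real.norm_eq_abs, mul_assoc, Finset.sum_mul]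
  refine mul_le_mul_of_nonneg_left ((norm_sum_le _ _).trans (Finset.sum_le_sum fun k _ => ?_))
    (abs_nonneg _)
  rw [norm_smul, Real.norm_eq_abs]
  have h1 : |ℓ k u + m k φ| ≤ ‖ℓ k‖ * |R| + ‖m k‖ * ‖φ‖ := by
    refine (abs_add_le _ _).trans (add_le_add ?_ ((m k).le_opNorm φ))
    exact ((ℓ k).le_opNorm u).trans (by gcongr; exact hu.le.trans (le_abs_self R))
  have h2 : 1 + |ℓ k u + m k φ| ≤ (1 + ‖ℓ k‖ * |R| + ‖m k‖) * (1 + ‖φ‖) := by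
    have : 0 ≤ ‖ℓ k‖ * |R| * ‖φ‖ := by positivity
    nlinarith [norm_nonneg (m k), norm_nonneg φ]
  calc |U₁ (ℓ k u + m k φ)| * ‖ℓ k‖
      ≤ ((|U₁ 0| + M) * (1 + |ℓ k u + m k φ|)) * ‖ℓ k‖ := by gcongr; exact h.abs_one_le _
    _ ≤ ((|U₁ 0| + M) * ((1 + ‖ℓ k‖ * |R| + ‖m k‖) * (1 + ‖φ‖))) * ‖ℓ k‖ := by gcongr
    _ = _ := by ring

theorem norm_gibbsScoreDeriv_le (h : IsGradPotential U U₁ U₂ A B M) :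
    ∃ C, 0 ≤ C ∧ ∀ (u : E) (φ : X), ‖gibbsScoreDeriv β U₂ ℓ m u φ‖ ≤ C := by
  have hM := h.bound_nonneg
  refine ⟨|β| * ∑ k, M * ‖ℓ k‖ * ‖ℓ k‖,
    mul_nonneg (abs_nonneg _) (Finset.sum_nonneg fun k _ => by positivity), fun u φ => ?_⟩
  rw [gibbsScoreDeriv, norm_smul, norm_neg, Real.norm_eq_abs]
  refine mul_le_mul_of_nonneg_left ((norm_sum_le _ _).trans (Finset.sum_le_sum fun k _ => ?_))
    (abs_nonneg _)
  rw [ContinuousLinearMap.norm_smulRight_apply, norm_smul, Real.norm_eq_abs]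
  gcongr
  exact h.bound _

/-- Quadratic growth of `U` and coercivity of the `m k` give Gaussian decay in `φ`, uniformly for
`u` in a ball, whose effect is absorbed in the constant. -/
theorem gibbsWeight_le (h : IsGradPotential U U₁ U₂ A B M) (hβ : 0 < β)
    (hm : ∀ φ, c * ‖φ‖ ^ 2 ≤ ∑ k, m k φ ^ 2) (R : ℝ) :
    ∃ C, 0 ≤ C ∧ ∀ u : E, ‖u‖ < R → ∀ φ : X,
      gibbsWeight β U ℓ m u φ ≤ C * Real.exp (-(β * A * c / 2) * ‖φ‖ ^ 2) := by
  refine ⟨Real.exp (β * ∑ k, (A * (‖ℓ k‖ * R) ^ 2 + B)), (Real.exp_pos _).le, fun u hu φ => ?_⟩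
  rw [gibbsWeight, ← Real.exp_add, Real.exp_le_exp]
  have hA := h.pos
  have h1 : ∀ k, A * (m k φ ^ 2 / 2) - (A * (‖ℓ k‖ * R) ^ 2 + B) ≤ U (ℓ k u + m k φ) := by
    intro k
    refine le_trans ?_ (h.lower _)
    have h2 : (ℓ k u) ^ 2 ≤ (‖ℓ k‖ * R) ^ 2 := by
      rw [← sq_abs (ℓ k u)]
      exact pow_le_pow_left₀ (abs_nonneg _) (((ℓ k).le_opNorm u).trans (by gcongr)) 2
    -- This is `(a + b)² ≥ b²/2 - a²`: twice the difference is `(2a + b)²`.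
    nlinarith [mul_nonneg hA.le (sq_nonneg (2 * ℓ k u + m k φ)), mul_le_mul_of_nonneg_left h2 hA.le]
  have h2 := Finset.sum_le_sum fun k (_ : k ∈ Finset.univ) => h1 k
  rw [Finset.sum_sub_distrib, ← Finset.mul_sum, ← Finset.sum_div] at h2
  have h3 := mul_le_mul_of_nonneg_left (hm φ) hA.le
  have h4 := mul_le_mul_of_nonneg_left h2 hβ.le
  have h5 := mul_le_mul_of_nonneg_left h3 hβ.le
  linarith

theorem continuous_gibbsWeight_smul_score (h : IsGradPotential U U₁ U₂ A B M) :
    Continuous fun p : E × X =>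
      gibbsWeight β U ℓ m p.1 p.2 • gibbsScore β U₁ ℓ m p.1 p.2 :=
  (continuous_gibbsWeight h).smul (continuous_gibbsScore h)

theorem continuous_gibbs_second (h : IsGradPotential U U₁ U₂ A B M) :
    Continuous fun p : E × X =>
      gibbsSecond β U U₁ U₂ ℓ m p.1 p.2 := by
  refine ((continuous_gibbsWeight h).smul (continuous_gibbsScoreDeriv h)).add ?_
  exact (ContinuousLinearMap.smulRightL ℝ E (E →L[ℝ] ℝ)).continuous₂.comp
    ((continuous_gibbsWeight_smul_score h).prodMk (continuous_gibbsScore h))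

variable [FiniteDimensional ℝ X] [MeasurableSpace X] [BorelSpace X] (μ : Measure X)
  [μ.IsAddHaarMeasure]

theorem integrable_gibbsWeight_smul {G : Type*} [NormedAddCommGroup G] [NormedSpace ℝ G]
    (h : IsGradPotential U U₁ U₂ A B M) (hβ : 0 < β) (hc : 0 < c)
    (hm : ∀ φ, c * ‖φ‖ ^ 2 ≤ ∑ k, m k φ ^ 2) (u : E) {P : X → G} (hP : Continuous P) {C : ℝ}
    (hPC : ∀ φ, ‖P φ‖ ≤ C * (1 + ‖φ‖) ^ 2) :
    Integrable (fun φ => gibbsWeight β U ℓ m u φ • P φ) μ := by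
  obtain ⟨C₀, hC₀, hw⟩ := gibbsWeight_le (ℓ := ℓ) h hβ hm (‖u‖ + 1)
  have hA := h.pos
  refine ((integrable_one_add_norm_sq_mul_exp μ
    (show 0 < β * A * c / 2 by positivity)).const_mul (C₀ * C)).mono'
    (Continuous.aestronglyMeasurable ?_) (.of_forall fun φ => ?_)
  · exact (Continuous.uncurry_left (f := gibbsWeight β U ℓ m) u (continuous_gibbsWeight h)).smul hP
  · rw [norm_smul, Real.norm_of_nonneg (show 0 ≤ gibbsWeight β U ℓ m u φ from (Real.exp_pos _).le)]
    calc _ ≤ (C₀ * Real.exp (-(β * A * c / 2) * ‖φ‖ ^ 2)) * (C * (1 + ‖φ‖) ^ 2) :=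
          mul_le_mul (hw u (by simp) φ) (hPC φ) (norm_nonneg _) (by positivity)
      _ = _ := by ring

theorem integrable_gibbsWeight
    (h : IsGradPotential U U₁ U₂ A B M) (hβ : 0 < β) (hc : 0 < c)
    (hm : ∀ φ, c * ‖φ‖ ^ 2 ≤ ∑ k, m k φ ^ 2) (u : E) :
    Integrable (fun φ => gibbsWeight β U ℓ m u φ) μ := by
  have := integrable_gibbsWeight_smul (ℓ := ℓ) μ h hβ hc hm u (P := fun _ => (1 : ℝ)) (C := 1)
    continuous_const (fun φ => by
      rw [norm_one]; nlinarith [norm_nonneg φ])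
  simpa using this

theorem integral_gibbsWeight_pos
    (h : IsGradPotential U U₁ U₂ A B M) (hβ : 0 < β) (hc : 0 < c)
    (hm : ∀ φ, c * ‖φ‖ ^ 2 ≤ ∑ k, m k φ ^ 2) (u : E) :
    0 < ∫ φ, gibbsWeight β U ℓ m u φ ∂μ :=
  integral_exp_pos (integrable_gibbsWeight μ h hβ hc hm u)

/-- The score grows linearly in `φ` and its derivative is bounded, so the weight and its first two
derivatives are at most a Gaussian times `(1 + ‖φ‖)²`; one dominating function serves all three. -/
theorem gibbs_locally_dominated
    (h : IsGradPotential U U₁ U₂ A B M) (hβ : 0 < β) (hc : 0 < c)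
    (hm : ∀ φ, c * ‖φ‖ ^ 2 ≤ ∑ k, m k φ ^ 2) (R : ℝ) :
    ∃ b : X → ℝ, Integrable b μ ∧ ∀ u : E, ‖u‖ < R → ∀ φ,
      ‖gibbsWeight β U ℓ m u φ‖ ≤ b φ ∧
      ‖gibbsWeight β U ℓ m u φ • gibbsScore β U₁ ℓ m u φ‖ ≤ b φ ∧
      ‖gibbsSecond β U U₁ U₂ ℓ m u φ‖ ≤ b φ := by
  obtain ⟨C₀, hC₀, hw⟩ := gibbsWeight_le (ℓ := ℓ) h hβ hm R
  obtain ⟨C₁, hC₁, hs⟩ := norm_gibbsScore_le (β := β) (ℓ := ℓ) (m := m) h R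
  obtain ⟨C₂, hC₂, hd⟩ := norm_gibbsScoreDeriv_le (β := β) (ℓ := ℓ) (m := m) h
  have hA := h.pos
  refine ⟨fun φ => C₀ * (1 + C₁ + C₂ + C₁ ^ 2) *
    ((1 + ‖φ‖) ^ 2 * Real.exp (-(β * A * c / 2) * ‖φ‖ ^ 2)),
    (integrable_one_add_norm_sq_mul_exp μ (by positivity)).const_mul _, fun u hu φ => ?_⟩
  have hw := hw u hu φ
  have hs := hs u hu φ
  have hd := hd u φ
  have hr := norm_nonneg φ
  set r := ‖φ‖
  set e := Real.exp (-(β * A * c / 2) * r ^ 2)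
  have he : 0 < e := Real.exp_pos _
  have hw0 : 0 ≤ gibbsWeight β U ℓ m u φ := (Real.exp_pos _).le
  have hr2 : 1 + r ≤ (1 + r) ^ 2 := by nlinarith
  have hr1 : 1 ≤ (1 + r) ^ 2 := by nlinarith
  have main : ∀ T, T ≤ (1 + C₁ + C₂ + C₁ ^ 2) * (1 + r) ^ 2 → 0 ≤ T →
      gibbsWeight β U ℓ m u φ * T ≤ C₀ * (1 + C₁ + C₂ + C₁ ^ 2) * ((1 + r) ^ 2 * e) := by
    intro T hT hT0
    calc _ ≤ (C₀ * e) * ((1 + C₁ + C₂ + C₁ ^ 2) * (1 + r) ^ 2) :=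
          mul_le_mul hw hT hT0 (by positivity)
      _ = _ := by ring
  have hb1 : C₁ * (1 + r) ≤ C₁ * (1 + r) ^ 2 := mul_le_mul_of_nonneg_left hr2 hC₁
  have hb2 : C₂ ≤ C₂ * (1 + r) ^ 2 := le_mul_of_one_le_right hC₂ hr1
  have hb3 : 0 ≤ C₁ ^ 2 * (1 + r) ^ 2 := by positivity
  have hb4 : 0 ≤ C₁ * (1 + r) ^ 2 := by positivity
  refine ⟨?_, ?_, ?_⟩
  · rw [Real.norm_of_nonneg hw0]
    have := main 1 (by nlinarith) zero_le_one
    rwa [mul_one] at this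
  · rw [norm_smul, Real.norm_of_nonneg hw0]
    exact main _ (by nlinarith) (norm_nonneg _)
  · refine (norm_add_le _ _).trans ?_
    rw [ContinuousLinearMap.norm_smulRight_apply, norm_smul, norm_smul, Real.norm_of_nonneg hw0,
      mul_assoc, ← mul_add]
    have : ‖gibbsScore β U₁ ℓ m u φ‖ * ‖gibbsScore β U₁ ℓ m u φ‖ ≤ C₁ ^ 2 * (1 + r) ^ 2 := by
      rw [← mul_pow, ← sq]; gcongr
    exact main _ (by nlinarith) (by positivity)

theorem hasFDerivAt_integral_gibbsWeight
    (h : IsGradPotential U U₁ U₂ A B M) (hβ : 0 < β) (hc : 0 < c)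
    (hm : ∀ φ, c * ‖φ‖ ^ 2 ≤ ∑ k, m k φ ^ 2) (u : E) :
    HasFDerivAt (fun u => ∫ φ, gibbsWeight β U ℓ m u φ ∂μ)
      (∫ φ, gibbsWeight β U ℓ m u φ • gibbsScore β U₁ ℓ m u φ ∂μ) u := by
  refine hasFDerivAt_integral_of_locally_dominated (fun u => ?_) (fun u => ?_) (fun R => ?_)
    (hasFDerivAt_gibbsWeight h) u
  · exact ((continuous_gibbsWeight h).comp (Continuous.prodMk_right u)).aestronglyMeasurable
  · exact ((continuous_gibbsWeight_smul_score h).comp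
      (Continuous.prodMk_right u)).aestronglyMeasurable
  · obtain ⟨b, hb, hle⟩ := gibbs_locally_dominated (ℓ := ℓ) μ h hβ hc hm R
    exact ⟨b, hb, fun u hu φ => ⟨(hle u hu φ).1, (hle u hu φ).2.1⟩⟩

theorem hasFDerivAt_integral_gibbsWeight_score
    (h : IsGradPotential U U₁ U₂ A B M) (hβ : 0 < β) (hc : 0 < c)
    (hm : ∀ φ, c * ‖φ‖ ^ 2 ≤ ∑ k, m k φ ^ 2) (u : E) :
    HasFDerivAt (fun u => ∫ φ, gibbsWeight β U ℓ m u φ • gibbsScore β U₁ ℓ m u φ ∂μ)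
      (∫ φ, gibbsSecond β U U₁ U₂ ℓ m u φ ∂μ) u := by
  refine hasFDerivAt_integral_of_locally_dominated (fun u => ?_) (fun u => ?_) (fun R => ?_)
    (fun u φ => (hasFDerivAt_gibbsWeight h u φ).smul (hasFDerivAt_gibbsScore h u φ)) u
  · exact ((continuous_gibbsWeight_smul_score h).comp
      (Continuous.prodMk_right u)).aestronglyMeasurable
  · exact (Continuous.uncurry_left (f := gibbsSecond β U U₁ U₂ ℓ m) u
      (continuous_gibbs_second h)).aestronglyMeasurable
  · obtain ⟨b, hb, hle⟩ := gibbs_locally_dominated (ℓ := ℓ) μ h hβ hc hm R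
    exact ⟨b, hb, fun u hu φ => (hle u hu φ).2⟩

theorem continuous_integral_gibbsSecond
    (h : IsGradPotential U U₁ U₂ A B M) (hβ : 0 < β) (hc : 0 < c)
    (hm : ∀ φ, c * ‖φ‖ ^ 2 ≤ ∑ k, m k φ ^ 2) :
    Continuous (fun u : E => ∫ φ, gibbsSecond β U U₁ U₂ ℓ m u φ ∂μ) := by
  have hcont := continuous_gibbs_second (β := β) (ℓ := ℓ) (m := m) h
  have hmeas : ∀ u : E, AEStronglyMeasurable (gibbsSecond β U U₁ U₂ ℓ m u) μ := fun u =>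
    (Continuous.uncurry_left u hcont).aestronglyMeasurable
  have hφ : ∀ φ : X, Continuous fun u => gibbsSecond β U U₁ U₂ ℓ m u φ := fun φ =>
    Continuous.uncurry_right φ hcont
  refine continuous_integral_of_locally_dominated (G := E →L[ℝ] E →L[ℝ] ℝ)
    (F := gibbsSecond β U U₁ U₂ ℓ m) hmeas (fun R => ?_) hφ
  obtain ⟨b, hb, hle⟩ := gibbs_locally_dominated (ℓ := ℓ) μ h hβ hc hm R
  exact ⟨b, hb, fun u hu φ => (hle u hu φ).2.2⟩

theorem contDiff_integral_gibbsWeight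
    (h : IsGradPotential U U₁ U₂ A B M) (hβ : 0 < β) (hc : 0 < c)
    (hm : ∀ φ, c * ‖φ‖ ^ 2 ≤ ∑ k, m k φ ^ 2) :
    ContDiff ℝ 2 (fun u : E => ∫ φ, gibbsWeight β U ℓ m u φ ∂μ) := by
  have h1 := hasFDerivAt_integral_gibbsWeight (ℓ := ℓ) μ h hβ hc hm
  have h2 := hasFDerivAt_integral_gibbsWeight_score (ℓ := ℓ) μ h hβ hc hm
  have h3 := continuous_integral_gibbsSecond (ℓ := ℓ) μ h hβ hc hm
  have h4 : ContDiff ℝ 1 (fun u : E => ∫ φ, gibbsWeight β U ℓ m u φ • gibbsScore β U₁ ℓ m u φ ∂μ) :=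
    contDiff_one_iff_hasFDerivAt.2 ⟨_, h3, h2⟩
  exact (contDiff_succ_iff_hasFDerivAt (n := 1)).2 ⟨_, h4, h1⟩

end Gibbs

/-! ### Real inequalities for products of force increments -/

theorem two_rpow_neg_inv_le {n : ℝ} (hn : 1 ≤ n) :
    (2 : ℝ) ^ (-(1 / n)) ≤ 1 - 2 ^ (-n) / 2 := by
  have hn0 : 0 < n := by linarith
  have h2 : n ≤ 2 ^ n := by
    have := one_add_mul_self_le_rpow_one_add (s := 1) (by norm_num) hn
    norm_num at this
    linarith
  set t : ℝ := 2 ^ (-n) / 2 with ht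
  have hpos : (0 : ℝ) < 2 ^ (-n) := by positivity
  have hle1 : (2 : ℝ) ^ (-n) ≤ 1 := Real.rpow_le_one_of_one_le_of_nonpos (by norm_num) (by linarith)
  have hnt : n * t ≤ 1 / 2 := by
    have : n * (2 : ℝ) ^ (-n) ≤ 1 := by
      rw [Real.rpow_neg (by norm_num), ← div_eq_mul_inv]
      exact (div_le_one (by positivity)).2 h2
    rw [ht]; linarith
  -- Bernoulli: `(1 - t)^n ≥ 1 - nt ≥ 1/2`; taking `n`-th roots finishes.
  have h3 := one_add_mul_self_le_rpow_one_add (s := -t) (by linarith) hn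
  have h4 : (1 / 2 : ℝ) ≤ (1 + -t) ^ n := by linarith
  have h5 := Real.rpow_le_rpow (by norm_num) h4 (show 0 ≤ 1 / n by positivity)
  rw [← Real.rpow_mul (by linarith), mul_one_div_cancel hn0.ne', Real.rpow_one] at h5
  rw [Real.rpow_neg (by norm_num), ← Real.inv_rpow (by norm_num)]
  norm_num at h5 ⊢
  linarith

/-- The right side is the tangent at `x² = 2` of the concave function `x² ↦ (x²)^(1-y)`. The value
`2` is the lower bound for the mean of the normalised squared distance of two independent copies. -/
theorem rpow_two_sub_le_young {x y : ℝ} (hx : 0 ≤ x) (hy0 : 0 ≤ y) (hy1 : y ≤ 1) :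
    x ^ (2 - 2 * y) ≤ 2 ^ (-y) * ((1 - y) * x ^ 2 + 2 * y) := by
  have h := Real.geom_mean_le_arith_mean2_weighted (show 0 ≤ 1 - y by linarith) hy0
    (show 0 ≤ x ^ 2 / 2 by positivity) zero_le_one (by ring)
  rw [Real.one_rpow, mul_one, mul_one, Real.div_rpow (by positivity) (by norm_num),
    ← Real.rpow_natCast x 2, ← Real.rpow_mul hx] at h
  have e : ((2 : ℕ) : ℝ) * (1 - y) = 2 - 2 * y := by push_cast; ring
  rw [e, div_le_iff₀ (by positivity)] at h
  have e2 : (2 : ℝ) ^ (1 - y) = 2 * 2 ^ (-y) := by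
    rw [sub_eq_add_neg, Real.rpow_add (by norm_num), Real.rpow_one]
  rw [e2] at h
  refine h.trans (le_of_eq ?_)
  rw [Real.rpow_natCast]
  ring

/-- `P`, `Q` bound the increments of `V'` and `Γ` those of `-g'`. If `Γ ≤ P` both factors are at
least `P - Γ`; otherwise the worst case is one factor `-(Γ - P)` against the other `Q`. -/
theorem sub_mul_sub_lower {P Q Γ α α' ρ ρ' : ℝ} (hP : 0 ≤ P) (hα : P ≤ α) (hα2 : α ≤ Q)
    (hρ : P ≤ ρ) (hρ2 : ρ ≤ Q) (hα' : 0 ≤ α') (hα'2 : α' ≤ Γ) (hρ' : 0 ≤ ρ') (hρ'2 : ρ' ≤ Γ) :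
    (Γ ≤ P → P ^ 2 - 2 * P * Γ ≤ (α - α') * (ρ - ρ')) ∧
      (P < Γ → -((Γ - P) * Q) ≤ (α - α') * (ρ - ρ')) := by
  refine ⟨fun h => ?_, fun h => ?_⟩
  · have : (P - Γ) * (P - Γ) ≤ (α - α') * (ρ - ρ') :=
      mul_le_mul (by linarith) (by linarith) (by linarith) (by linarith)
    linarith [sq_nonneg Γ, show (P - Γ) * (P - Γ) = P ^ 2 - 2 * P * Γ + Γ ^ 2 by ring]
  · have hQ : 0 ≤ Q := by linarith
    have hz : 0 ≤ (Γ - P) * Q := mul_nonneg (by linarith) hQ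
    rcases le_total 0 (α - α') with ha | ha <;> rcases le_total 0 (ρ - ρ') with hb | hb
    · linarith [mul_nonneg ha hb]
    · have := mul_le_mul (show α - α' ≤ Q by linarith)
        (show -(ρ - ρ') ≤ Γ - P by linarith) (by linarith) hQ
      linarith
    · have := mul_le_mul (show -(α - α') ≤ Γ - P by linarith)
        (show ρ - ρ' ≤ Q by linarith) hb (by linarith)
      linarith
    · linarith [mul_nonneg_of_nonpos_of_nonpos ha hb]

/-- Controls the regime where the Hölder part can beat the slope `C₁`. There `x^(2y) ≤ η / C₁` with
`y = 1/(2q)`, and smallness of `η` turns this into `x^(2y) ≤ s / (2C₂)`; raising it to the power `2q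
- 1` bounds `x^(2-2y)` and leaves only the error `s η 2^(1-2q)`. -/
theorem mul_rpow_le_of_steep {C₁ C₂ s η q x : ℝ} (hC₁ : 0 < C₁) (hC₂ : 0 < C₂) (hs0 : 0 < s)
    (hss : s * s = C₁ * C₂) (hsC₂ : s ≤ C₂) (hη : 0 ≤ η) (hq : 1 ≤ q)
    (hsmall : 2 * s * η < C₁ ^ 2) (hx : 0 ≤ x)
    (h : C₁ * x < η * x ^ (1 - 2 * (1 / (2 * q)))) :
    C₂ * (η * x ^ (2 - 2 * (1 / (2 * q)))) ≤ s * η * 2 ^ (1 - 2 * q) := by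
  have hq0 : 0 < q := by linarith
  set y := 1 / (2 * q) with hy
  have hy1 : y ≤ 1 / 2 := by
    rw [hy]; exact one_div_le_one_div_of_le (by norm_num) (by linarith)
  rcases hx.eq_or_lt with rfl | hx0
  · rw [Real.zero_rpow (by linarith), mul_zero, mul_zero]
    positivity
  have h1 : C₁ * x ^ (2 * y) ≤ η := by
    have h1 : C₁ * (x ^ (2 * y) * x ^ (1 - 2 * y)) < η * x ^ (1 - 2 * y) := by
      rw [← Real.rpow_add hx0]; simpa using h
    rw [← mul_assoc] at h1
    exact (lt_of_mul_lt_mul_right h1 (by positivity)).le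
  have h2 : x ^ (2 * y) ≤ s / C₂ / 2 := by
    rw [div_div, le_div_iff₀ (by positivity)]
    have h3 : C₁ * (2 * s * x ^ (2 * y)) ≤ C₁ * C₁ := by
      have := mul_le_mul_of_nonneg_left h1 (show 0 ≤ 2 * s by positivity)
      linarith
    have h3 := le_of_mul_le_mul_left h3 hC₁
    have h4 : s * (x ^ (2 * y) * (C₂ * 2)) ≤ s * s := by
      rw [hss]
      have := mul_le_mul_of_nonneg_right h3 hC₂.le
      linarith
    exact le_of_mul_le_mul_left h4 hs0
  have h3 : x ^ (2 - 2 * y) ≤ (s / C₂ / 2) ^ (2 * q - 1) := by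
    have : x ^ (2 - 2 * y) = (x ^ (2 * y)) ^ (2 * q - 1) := by
      rw [← Real.rpow_mul hx]
      congr 1
      rw [hy]; field_simp
    rw [this]
    exact Real.rpow_le_rpow (by positivity) h2 (by linarith)
  have h4 : (s / C₂ / 2) ^ (2 * q - 1) ≤ s / C₂ * 2 ^ (1 - 2 * q) := by
    rw [Real.div_rpow (by positivity) (by norm_num), div_eq_mul_inv,
      ← Real.rpow_neg (by norm_num), neg_sub]
    gcongr
    have := Real.rpow_le_rpow_of_exponent_ge (x := s / C₂) (by positivity)
      ((div_le_one hC₂).2 hsC₂) (show 1 ≤ 2 * q - 1 by linarith)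
    simpa using this
  calc C₂ * (η * x ^ (2 - 2 * y)) ≤ C₂ * (η * (s / C₂ * 2 ^ (1 - 2 * q))) := by
        gcongr; exact h3.trans h4
    _ = s * η * 2 ^ (1 - 2 * q) := by field_simp

/-- Lower bound for the product of two increments, each the difference of an increment with slope
in `[C₁, C₂]` and a nonnegative increment with Hölder exponent `1 - 1 / q`. -/
theorem increment_mul_lower_normalized {C₁ C₂ η q x α α' ρ ρ' : ℝ} (hC₁ : 0 < C₁) (hC : C₁ ≤ C₂)
    (hη : 0 ≤ η) (hq : 1 ≤ q) (hsmall : 2 * √(C₁ * C₂) * η < C₁ ^ 2) (hx : 0 ≤ x)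
    (hα : C₁ * x ≤ α) (hα2 : α ≤ C₂ * x) (hρ : C₁ * x ≤ ρ) (hρ2 : ρ ≤ C₂ * x)
    (hα' : 0 ≤ α') (hα'2 : α' ≤ η * x ^ (1 - 1 / q)) (hρ' : 0 ≤ ρ')
    (hρ'2 : ρ' ≤ η * x ^ (1 - 1 / q)) :
    (C₁ ^ 2 - 2 * C₁ * η * (2 ^ (-(1 / (2 * q))) * (1 - 1 / (2 * q)))) * (x ^ 2 - 2) +
      2 * (C₁ ^ 2 - 2 * √(C₁ * C₂) * η) ≤ (α - α') * (ρ - ρ') := by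
  have hC₂ : 0 < C₂ := hC₁.trans_le hC
  have hq0 : 0 < q := by linarith
  set s := √(C₁ * C₂) with hs
  have hss : s * s = C₁ * C₂ := Real.mul_self_sqrt (by positivity)
  have hs0 : 0 < s := Real.sqrt_pos.2 (by positivity)
  have hC₁s : C₁ ≤ s := by
    rw [hs]; exact Real.le_sqrt_of_sq_le (by nlinarith)
  have hsC₂ : s ≤ C₂ := by
    rw [hs]; exact Real.sqrt_le_iff.2 ⟨hC₂.le, by nlinarith⟩
  set y := 1 / (2 * q) with hy
  have hy0 : 0 < y := by positivity
  have hy1 : y ≤ 1 / 2 := by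
    rw [hy]; exact one_div_le_one_div_of_le (by norm_num) (by linarith)
  have e1 : 1 / q = 2 * y := by rw [hy]; field_simp
  rw [e1] at hα'2 hρ'2
  set Γ := η * x ^ (1 - 2 * y) with hΓ
  set T := η * x ^ (2 - 2 * y) with hT
  have hΓ0 : 0 ≤ Γ := by positivity
  have hxΓ : x * Γ = T := by
    rw [hΓ, hT, show 2 - 2 * y = (1 - 2 * y) + 1 by ring,
      Real.rpow_add_one' hx (by linarith)]
    ring
  set R := s * η * 2 ^ (1 - 2 * q) with hR
  have hR0 : 0 ≤ R := by positivity
  -- One lower bound for both regimes, with `R` paying for the steep one.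
  have step1 : C₁ ^ 2 * x ^ 2 - 2 * C₁ * T - R ≤ (α - α') * (ρ - ρ') := by
    have hP : 0 ≤ C₁ * x := by positivity
    have hT0 : 0 ≤ T := by positivity
    obtain ⟨h1, h2⟩ := sub_mul_sub_lower hP hα hα2 hρ hρ2 hα' hα'2 hρ' hρ'2
    rcases le_or_gt Γ (C₁ * x) with h | h
    · refine le_trans ?_ (h1 h)
      rw [← hxΓ]
      linarith
    · refine le_trans ?_ (h2 h)
      have hTR := mul_rpow_le_of_steep hC₁ hC₂ hs0 hss hsC₂ hη hq hsmall hx h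
      have h3 : 0 ≤ (C₂ - C₁) * C₁ * x ^ 2 :=
        mul_nonneg (mul_nonneg (by linarith) hC₁.le) (sq_nonneg x)
      have h4 : (Γ - C₁ * x) * (C₂ * x) = C₂ * T - C₁ * C₂ * x ^ 2 := by rw [← hxΓ]; ring
      have h5 := mul_nonneg hC₁.le hT0
      rw [h4]
      linarith
  have step2 := rpow_two_sub_le_young hx hy0.le (by linarith : y ≤ 1)
  have hB := two_rpow_neg_inv_le (n := 2 * q) (by linarith)
  rw [← hy] at hB
  set b : ℝ := 2 ^ (-y) with hb
  have hb0 : 0 < b := by positivity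
  have e3 : (2 : ℝ) ^ (1 - 2 * q) = 2 * 2 ^ (-(2 * q)) := by
    rw [sub_eq_add_neg, Real.rpow_add (by norm_num), Real.rpow_one]
  have h5 : 2 * C₁ * T ≤ 2 * C₁ * η * (b * ((1 - y) * x ^ 2 + 2 * y)) := by
    rw [hT, ← mul_assoc]
    exact mul_le_mul_of_nonneg_left step2 (by positivity)
  -- The gain `1 - b ≥ 2^(-2q)/2` matches `R/4` exactly. Replacing `C₁` by `s = √(C₁C₂)` thus
  -- absorbs the error, which is why `√(C₁C₂)` appears in `c_l`.
  have h6 : C₁ * η * b + R / 4 ≤ s * η := by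
    have : C₁ * η * b ≤ s * η * b := by gcongr
    rw [hR, e3]
    have h7 := mul_le_mul_of_nonneg_left hB (show 0 ≤ s * η by positivity)
    linarith
  linarith

/-- Lower bound for the product of two increments, each the difference of an increment with slope
in `[C₁, C₂]` and a nonnegative increment with Hölder exponent `1 - 1 / q`. -/
theorem increment_mul_lower {C₁ C₂ G q a : ℝ} (hC₁ : 0 < C₁) (hC : C₁ ≤ C₂) (ha : 0 < a)
    (hG : 0 ≤ G) (hq : 1 ≤ q) (hsmall : 2 * √(C₁ * C₂) * (G * a ^ (1 / (2 * q))) < C₁ ^ 2) :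
    ∃ k, 0 ≤ k ∧ ∀ {δ α α' ρ ρ' : ℝ}, 0 ≤ δ → C₁ * δ ≤ α → α ≤ C₂ * δ → C₁ * δ ≤ ρ →
      ρ ≤ C₂ * δ → 0 ≤ α' → α' ≤ G * δ ^ (1 - 1 / q) → 0 ≤ ρ' → ρ' ≤ G * δ ^ (1 - 1 / q) →
      k * (δ ^ 2 - 2 / a) + 2 * ((C₁ ^ 2 - 2 * √(C₁ * C₂) * (G * a ^ (1 / (2 * q)))) / a) ≤
        (α - α') * (ρ - ρ') := by
  have hq0 : 0 < q := by linarith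
  have hC₂ : 0 < C₂ := hC₁.trans_le hC
  set η := G * a ^ (1 / (2 * q)) with hη
  have hη0 : 0 ≤ η := by positivity
  have hy1 : 1 / (2 * q) ≤ 1 := by rw [div_le_one (by positivity)]; linarith
  refine ⟨C₁ ^ 2 - 2 * C₁ * η * (2 ^ (-(1 / (2 * q))) * (1 - 1 / (2 * q))), ?_, ?_⟩
  · have h1 : (2 : ℝ) ^ (-(1 / (2 * q))) * (1 - 1 / (2 * q)) ≤ 1 := by
      refine mul_le_one₀ (Real.rpow_le_one_of_one_le_of_nonpos (by norm_num) ?_) (by linarith) ?_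
      · simp only [Left.neg_nonpos_iff]; positivity
      · simp only [tsub_le_iff_right, le_add_iff_nonneg_right]; positivity
    have h2 : C₁ ≤ √(C₁ * C₂) := Real.le_sqrt_of_sq_le (by nlinarith)
    have h3 := mul_le_mul_of_nonneg_left h1 (show 0 ≤ 2 * C₁ * η by positivity)
    have h4 := mul_le_mul_of_nonneg_right h2 hη0
    linarith
  · intro δ α α' ρ ρ' hδ hα hα2 hρ hρ2 hα' hα'2 hρ' hρ'2
    -- Scaling distances and increments by `√a` turns `2 / a` into `2` and the Hölder constant `G`
    -- into `η`.
    set r := √a with hr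
    have hr0 : 0 < r := Real.sqrt_pos.2 ha
    have hrr : r * r = a := Real.mul_self_sqrt ha.le
    have e : η * (r * δ) ^ (1 - 1 / q) = r * (G * δ ^ (1 - 1 / q)) := by
      rw [Real.mul_rpow hr0.le hδ, hη, hr, Real.sqrt_eq_rpow, ← Real.rpow_mul ha.le]
      have : a ^ (1 / (2 * q)) * a ^ (1 / 2 * (1 - 1 / q)) = a ^ (1 / 2 : ℝ) := by
        rw [← Real.rpow_add ha]
        congr 1
        field_simp
        ring
      rw [← this]
      ring
    have key := increment_mul_lower_normalized (x := r * δ) (α := r * α) (α' := r * α')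
      (ρ := r * ρ) (ρ' := r * ρ') hC₁ hC hη0 hq hsmall (by positivity)
      (by nlinarith) (by nlinarith) (by nlinarith) (by nlinarith) (by positivity)
      (by rw [e]; gcongr) (by positivity) (by rw [e]; gcongr)
    rw [show (r * α - r * α') * (r * ρ - r * ρ') = a * ((α - α') * (ρ - ρ')) by
      rw [← hrr]; ring, mul_pow, sq r, hrr] at key
    refine le_of_mul_le_mul_left (le_trans (le_of_eq ?_) key) ha
    field_simp

/-- Hölder on `(a, b]`: the `L¹` norm of `g₂` there is at most its `L^q` norm times the length to
the power `1 - 1/q`. -/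
theorem abs_sub_le_lqNorm_mul_rpow {g₁ g₂ : ℝ → ℝ} (hg : ∀ s, HasDerivAt g₁ (g₂ s) s)
    (hc : Continuous g₂) {q : ℝ} (hq : 1 ≤ q) (hgq : MemLp g₂ (ENNReal.ofReal q) volume)
    {a b : ℝ} (hab : a ≤ b) :
    |g₁ b - g₁ a| ≤ GradModel.lqNorm q g₂ * (b - a) ^ (1 - 1 / q) := by
  have h1 : ∫ x in a..b, g₂ x = g₁ b - g₁ a :=
    intervalIntegral.integral_eq_sub_of_hasDerivAt (fun x _ => hg x) (hc.intervalIntegrable _ _)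
  rw [← h1, intervalIntegral.integral_of_le hab]
  have hle := eLpNorm_le_eLpNorm_mul_rpow_measure_univ (μ := volume.restrict (Set.Ioc a b))
    (show (1 : ENNReal) ≤ ENNReal.ofReal q by simpa using hq) hc.aestronglyMeasurable (f := g₂)
  have hle2 : eLpNorm g₂ 1 (volume.restrict (Set.Ioc a b)) ≤
      eLpNorm g₂ (ENNReal.ofReal q) volume * ENNReal.ofReal (b - a) ^ (1 - 1 / q) := by
    refine hle.trans ?_
    rw [Measure.restrict_apply_univ, Real.volume_Ioc, ENNReal.toReal_one,
      ENNReal.toReal_ofReal (by linarith), div_one]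
    gcongr
    exact Measure.restrict_le_self
  have h2 : ‖∫ x in Set.Ioc a b, g₂ x‖ ≤ (eLpNorm g₂ 1 (volume.restrict (Set.Ioc a b))).toReal := by
    refine (norm_integral_le_integral_norm _).trans (le_of_eq ?_)
    rw [eLpNorm_one_eq_lintegral_enorm, integral_norm_eq_lintegral_enorm hc.aestronglyMeasurable]
  have he : 0 ≤ 1 - 1 / q := by
    rw [sub_nonneg, div_le_one (by linarith)]; exact hq
  refine h2.trans ?_
  rw [GradModel.lqNorm, ← ENNReal.toReal_ofReal (show 0 ≤ b - a by linarith),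
    ENNReal.toReal_rpow, ← ENNReal.toReal_mul]
  exact ENNReal.toReal_mono (ENNReal.mul_ne_top hgq.eLpNorm_ne_top
    (ENNReal.rpow_ne_top_of_nonneg he ENNReal.ofReal_ne_top)) hle2

theorem two_mul_covLower {d : ℕ} (hd : 0 < d) {β C₁ C₂ q G : ℝ} (hβ : 0 < β) (hC₂ : 0 < C₂)
    (hq : 1 ≤ q) :
    2 * GradModel.covLower d β C₁ C₂ q G =
      (C₁ ^ 2 - 2 * √(C₁ * C₂) * (G * (2 * d * C₂ * β) ^ (1 / (2 * q)))) / (2 * d * C₂ * β) := by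
  have hd' : (0 : ℝ) < d := by exact_mod_cast hd
  have hq0 : 0 < q := by linarith
  unfold GradModel.covLower
  set a : ℝ := 2 * d * C₂ * β with ha
  have ha0 : 0 < a := by positivity
  rw [show (4 * d * C₂ * β : ℝ) = 2 * a by rw [ha]; ring,
    show (2 * q - 1) / (2 * q) = 1 - 1 / (2 * q) by field_simp,
    Real.rpow_sub (by positivity), Real.rpow_one, Real.mul_rpow (by norm_num) ha0.le]
  have h1 : (0 : ℝ) < 2 ^ (1 / (2 * q)) := by positivity
  have h2 : 0 < a ^ (1 / (2 * q)) := by positivity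
  field_simp

/-- Condition (A2) multiplied by `√C₁`, with `(q + 1)/(2q)` split as `1/2 + 1/(2q)`. With
`two_mul_covLower` it says precisely that `c_l > 0`. -/
theorem small_of_norm_condition {d : ℕ} (hd : 0 < d) {β C₁ C₂ q G : ℝ} (hβ : 0 < β)
    (hC₁ : 0 < C₁) (hC₂ : 0 < C₂) (hq : 1 ≤ q)
    (h : β ^ (1 / (2 * q)) * G <
      C₁ ^ (3 / 2 : ℝ) / (2 * C₂ ^ ((q + 1) / (2 * q)) * (2 * d : ℝ) ^ (1 / (2 * q)))) :
    2 * √(C₁ * C₂) * (G * (2 * d * C₂ * β) ^ (1 / (2 * q))) < C₁ ^ 2 := by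
  have hd' : (0 : ℝ) < d := by exact_mod_cast hd
  have hq0 : 0 < q := by linarith
  rw [show (q + 1) / (2 * q) = 1 / 2 + 1 / (2 * q) by field_simp, Real.rpow_add hC₂,
    ← Real.sqrt_eq_rpow, lt_div_iff₀ (by positivity)] at h
  rw [Real.mul_rpow (by positivity) hβ.le, Real.mul_rpow (by positivity) hC₂.le,
    Real.sqrt_mul hC₁.le]
  have e : C₁ ^ 2 = √C₁ * C₁ ^ (3 / 2 : ℝ) := by
    rw [Real.sqrt_eq_rpow, ← Real.rpow_add hC₁, ← Real.rpow_natCast]; norm_num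
  rw [e]
  have := mul_lt_mul_of_pos_left h (Real.sqrt_pos.2 hC₁)
  linarith

/-! ### The one-site measure: integration by parts, variance and covariance -/

theorem integrable_linear_combination {α : Type*} [MeasurableSpace α] {μ : Measure α}
    {f₀ f₁ f₂ f₃ : α → ℝ} (h₀ : Integrable f₀ μ)
    (h₁ : Integrable f₁ μ) (h₂ : Integrable f₂ μ) (h₃ : Integrable f₃ μ) (a b c d : ℝ) :
    Integrable (fun t => a * f₀ t + b * f₁ t + c * f₂ t + d * f₃ t) μ :=
  (((h₀.const_mul a).add (h₁.const_mul b)).add (h₂.const_mul c)).add (h₃.const_mul d)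

theorem integral_linear_combination {α : Type*} [MeasurableSpace α] {μ : Measure α}
    {f₀ f₁ f₂ f₃ : α → ℝ} (h₀ : Integrable f₀ μ)
    (h₁ : Integrable f₁ μ) (h₂ : Integrable f₂ μ) (h₃ : Integrable f₃ μ) (a b c d : ℝ) :
    ∫ t, (a * f₀ t + b * f₁ t + c * f₂ t + d * f₃ t) ∂μ =
      a * (∫ t, f₀ t ∂μ) + b * (∫ t, f₁ t ∂μ) + c * (∫ t, f₂ t ∂μ) + d * ∫ t, f₃ t ∂μ := by
  have i1 : Integrable (fun t => a * f₀ t + b * f₁ t) μ := (h₀.const_mul a).add (h₁.const_mul b)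
  have i2 : Integrable (fun t => a * f₀ t + b * f₁ t + c * f₂ t) μ := i1.add (h₂.const_mul c)
  rw [integral_add i2 (h₃.const_mul d), integral_add i1 (h₂.const_mul c),
    integral_add (h₀.const_mul a) (h₁.const_mul b)]
  simp only [integral_const_mul]

section OneSite

variable {K : Type*} [Fintype K] {U U₁ U₂ : ℝ → ℝ} {A B M β : ℝ}

/-- The functional `t ↦ -t`. -/
noncomputable def negFunctional : ℝ →L[ℝ] ℝ := -ContinuousLinearMap.id ℝ ℝ

@[simp] theorem negFunctional_apply (t : ℝ) : negFunctional t = -t := rfl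

/-- The Boltzmann weight of a single height `t` with neighbouring heights `z`. -/
noncomputable def siteWeight (β : ℝ) (U : ℝ → ℝ) (z : K → ℝ) (t : ℝ) : ℝ :=
  gibbsWeight β U (fun k => ContinuousLinearMap.proj (R := ℝ) (φ := fun _ : K => ℝ) k)
    (fun _ => negFunctional) z t

theorem siteWeight_eq (z : K → ℝ) (t : ℝ) :
    siteWeight β U z t = Real.exp (-β * ∑ k, U (z k - t)) := by
  simp [siteWeight, gibbsWeight, sub_eq_add_neg]

theorem siteWeight_pos (z : K → ℝ) (t : ℝ) : 0 < siteWeight β U z t := Real.exp_pos _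

theorem site_coercive [Nonempty K] (φ : ℝ) :
    1 * ‖φ‖ ^ 2 ≤ ∑ _k : K, negFunctional φ ^ 2 := by
  have : (1 : ℝ) ≤ Fintype.card K := by exact_mod_cast Fintype.card_pos
  simp only [negFunctional_apply, Finset.sum_const, Finset.card_univ, nsmul_eq_mul,
    Real.norm_eq_abs, sq_abs, neg_sq]
  nlinarith [sq_nonneg φ]

theorem hasDerivAt_siteWeight (h : IsGradPotential U U₁ U₂ A B M)
    (z : K → ℝ) (t : ℝ) :
    HasDerivAt (siteWeight β U z) (siteWeight β U z t * (β * ∑ k, U₁ (z k - t))) t := by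
  have h1 : HasDerivAt (fun t => Real.exp (-β * ∑ k, U (z k - t)))
      (Real.exp (-β * ∑ k, U (z k - t)) * (-β * ∑ k, U₁ (z k - t) * -1)) t := by
    refine (HasDerivAt.const_mul (-β) (HasDerivAt.fun_sum fun k _ => ?_)).exp
    exact (h.deriv_one _).comp t ((hasDerivAt_id t).const_sub (z k))
  rw [show siteWeight β U z = _ from funext (siteWeight_eq z)]
  convert h1 using 1
  simp

variable [Nonempty K]

theorem integrable_siteWeight_mul (h : IsGradPotential U U₁ U₂ A B M) (hβ : 0 < β)
    (z : K → ℝ) {P : ℝ → ℝ} (hP : Continuous P) {C : ℝ}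
    (hPC : ∀ t, |P t| ≤ C * (1 + |t|) ^ 2) :
    Integrable (fun t => siteWeight β U z t * P t) :=
  integrable_gibbsWeight_smul volume h hβ one_pos site_coercive z hP hPC

/-- Functions of at most linear growth are closed under products up to quadratic growth. -/
theorem integrable_siteWeight_mul_mul (h : IsGradPotential U U₁ U₂ A B M) (hβ : 0 < β)
    (z : K → ℝ) {P Q : ℝ → ℝ} (hP : Continuous P)
    (hQ : Continuous Q) {C D : ℝ} (hPC : ∀ t, |P t| ≤ C * (1 + |t|))
    (hQD : ∀ t, |Q t| ≤ D * (1 + |t|)) :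
    Integrable (fun t => siteWeight β U z t * (P t * Q t)) := by
  refine integrable_siteWeight_mul h hβ z (hP.mul hQ) (C := C * D) fun t => ?_
  rw [abs_mul]
  refine (mul_le_mul (hPC t) (hQD t) (abs_nonneg _) ((abs_nonneg _).trans (hPC t))).trans ?_
  exact le_of_eq (by ring)

theorem integrable_siteWeight_linear (h : IsGradPotential U U₁ U₂ A B M) (hβ : 0 < β)
    (z : K → ℝ) {P : ℝ → ℝ} (hP : Continuous P)
    {C : ℝ} (hPC : ∀ t, |P t| ≤ C * (1 + |t|)) :
    Integrable (fun t => siteWeight β U z t * P t) := by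
  have := integrable_siteWeight_mul_mul h hβ z hP continuous_const (Q := fun _ => 1) (D := 1) hPC
    (fun t => by simp)
  simpa using this

/-- Integration by parts against the one-site weight. -/
theorem integral_siteWeight_deriv (h : IsGradPotential U U₁ U₂ A B M) (hβ : 0 < β)
    (z : K → ℝ) {ψ ψ' : ℝ → ℝ} (hψ : ∀ t, HasDerivAt ψ (ψ' t) t)
    (hψ' : Continuous ψ') {C C' : ℝ} (hC : ∀ t, |ψ t| ≤ C * (1 + |t|)) (hC' : ∀ t, |ψ' t| ≤ C') :
    ∫ t, siteWeight β U z t * ψ' t =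
      -β * ∑ k, ∫ t, siteWeight β U z t * (ψ t * U₁ (z k - t)) := by
  have hc : Continuous ψ := continuous_iff_continuousAt.2 fun t => (hψ t).continuousAt
  have hC'0 : 0 ≤ C' := (abs_nonneg _).trans (hC' 0)
  have hU : ∀ k, Continuous fun t => U₁ (z k - t) := fun k =>
    h.cont_one.comp (continuous_const.sub continuous_id)
  have i1 : ∀ k, Integrable fun t => siteWeight β U z t * (ψ t * U₁ (z k - t)) := fun k => by
    obtain ⟨D, -, hD⟩ := h.abs_one_sub_le (z k)
    exact integrable_siteWeight_mul_mul h hβ z hc (hU k) hC hD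
  have i2 : Integrable fun t => siteWeight β U z t * ψ' t :=
    integrable_siteWeight_linear h hβ z hψ' (C := C') fun t =>
      (hC' t).trans (by nlinarith [abs_nonneg t])
  have i3 : Integrable fun t => siteWeight β U z t * ψ t :=
    integrable_siteWeight_linear h hβ z hc hC
  have i4 : Integrable fun t => β * ∑ k, siteWeight β U z t * (ψ t * U₁ (z k - t)) :=
    (integrable_finsetSum _ fun k _ => i1 k).const_mul β
  have hd : ∀ t, HasDerivAt (fun t => siteWeight β U z t * ψ t)
      (siteWeight β U z t * ψ' t + β * ∑ k, siteWeight β U z t * (ψ t * U₁ (z k - t))) t := by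
    intro t
    refine ((hasDerivAt_siteWeight h z t).mul (hψ t)).congr_deriv ?_
    rw [← Finset.mul_sum, ← Finset.mul_sum]
    ring
  have := integral_eq_zero_of_hasDerivAt_of_integrable hd (i2.add i4) i3
  rw [integral_add i2 i4, integral_const_mul, integral_finsetSum _ fun k _ => i1 k] at this
  linarith

theorem integral_siteWeight_pos (h : IsGradPotential U U₁ U₂ A B M) (hβ : 0 < β)
    (z : K → ℝ) : 0 < ∫ t, siteWeight β U z t :=
  integral_gibbsWeight_pos volume h hβ one_pos site_coercive z

/-- Integration by parts with `ψ = 1`: the total mean force vanishes. -/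
theorem sum_integral_siteWeight_one (h : IsGradPotential U U₁ U₂ A B M) (hβ : 0 < β)
    (z : K → ℝ) :
    ∑ k, ∫ t, siteWeight β U z t * U₁ (z k - t) = 0 := by
  have := integral_siteWeight_deriv h hβ z (ψ := fun _ => 1) (ψ' := fun _ => 0) (C := 1) (C' := 0)
    (fun t => hasDerivAt_const t 1) continuous_const (fun t => by simp) (fun t => by simp)
  simp only [mul_zero, integral_zero, one_mul, neg_mul, zero_eq_neg, mul_eq_zero, hβ.ne',
    false_or] at this
  exact this

/-- Integration by parts against the force of neighbour `i`. It expresses the diagonal contribution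
`U₂` to the Hessian of the free energy through products of forces. -/
theorem integral_siteWeight_two (h : IsGradPotential U U₁ U₂ A B M) (hβ : 0 < β)
    (z : K → ℝ) (i : K) :
    ∫ t, siteWeight β U z t * U₂ (z i - t) =
      β * ∑ k, ∫ t, siteWeight β U z t * (U₁ (z i - t) * U₁ (z k - t)) := by
  obtain ⟨D, -, hD⟩ := h.abs_one_sub_le (z i)
  have := integral_siteWeight_deriv h hβ z (ψ := fun t => U₁ (z i - t))
    (ψ' := fun t => -U₂ (z i - t)) (C := D) (C' := M)
    (fun t => by
      have := (h.deriv_two _).comp t ((hasDerivAt_id t).const_sub (z i))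
      rw [mul_neg_one] at this
      exact this)
    (h.cont_two.comp (continuous_const.sub continuous_id)).neg hD
    (fun t => by rw [abs_neg]; exact h.bound _)
  simp only [mul_neg, integral_neg, neg_mul, neg_inj] at this
  exact this

/-- The variance of the one-site measure is at least the inverse of an upper bound for the second
derivative of its potential. -/
theorem variance_siteWeight_ge (h : IsGradPotential U U₁ U₂ A B M) (hβ : 0 < β)
    (z : K → ℝ) {C₂ : ℝ} (hU : ∀ s, U₂ s ≤ C₂) {a : ℝ} (ha : 0 < a)
    (haC : β * (Fintype.card K * C₂) ≤ a) :
    (∫ t, siteWeight β U z t) ^ 2 / a ≤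
      (∫ t, siteWeight β U z t) * (∫ t, siteWeight β U z t * t ^ 2) -
        (∫ t, siteWeight β U z t * t) ^ 2 := by
  have hW := integral_siteWeight_pos h hβ z
  have hid : ∀ t : ℝ, |t| ≤ 1 * (1 + |t|) := fun t => by linarith
  have j0 : Integrable fun t => siteWeight β U z t := by
    simpa using integrable_siteWeight_linear h hβ z (P := fun _ => 1) continuous_const (C := 1)
      (fun t => by simp)
  have j1 := integrable_siteWeight_linear h hβ z continuous_id hid
  have j2 := integrable_siteWeight_mul_mul h hβ z continuous_id continuous_id hid hid
  simp only [id, ← sq] at j1 j2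
  set W := ∫ t, siteWeight β U z t with hWdef
  set W₁ := ∫ t, siteWeight β U z t * t with hW₁
  set W₂ := ∫ t, siteWeight β U z t * t ^ 2 with hW₂
  set m := W₁ / W with hm
  choose D hD0 hD using fun k => h.abs_one_sub_le (z k)
  have hU₁ : ∀ k, Continuous fun t => U₁ (z k - t) := fun k =>
    h.cont_one.comp (continuous_const.sub continuous_id)
  set S : ℝ → ℝ := fun t => ∑ k, U₁ (z k - t) with hS
  have hSc : Continuous S := continuous_finsetSum _ fun k _ => hU₁ k
  have hSD : ∀ t, |S t| ≤ (∑ k, D k) * (1 + |t|) := fun t => by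
    rw [Finset.sum_mul]
    exact (Finset.abs_sum_le_sum_abs _ _).trans (Finset.sum_le_sum fun k _ => hD k t)
  have hmc : Continuous fun t : ℝ => t - m := continuous_id.sub continuous_const
  have hmD : ∀ t : ℝ, |t - m| ≤ (1 + |m|) * (1 + |t|) := fun t => by
    nlinarith [abs_sub t m, abs_nonneg m, abs_nonneg t, mul_nonneg (abs_nonneg m) (abs_nonneg t)]
  have jS := integrable_siteWeight_mul_mul h hβ z hSc hSc hSD hSD
  have jmS := integrable_siteWeight_mul_mul h hβ z hmc hSc hmD hSD
  have jm := integrable_siteWeight_mul_mul h hβ z hmc hmc hmD hmD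
  have jmU := fun k => integrable_siteWeight_mul_mul h hβ z hmc (hU₁ k) hmD (hD k)
  have jSU := fun i k => integrable_siteWeight_mul_mul h hβ z (hU₁ i) (hU₁ k) (hD i) (hD k)
  have eS : β * ∫ t, siteWeight β U z t * (S t * S t) ≤ Fintype.card K * C₂ * W := by
    have e1 : ∫ t, siteWeight β U z t * (S t * S t) =
        ∑ i, ∑ k, ∫ t, siteWeight β U z t * (U₁ (z i - t) * U₁ (z k - t)) := by
      simp_rw [← integral_finsetSum _ fun k _ => jSU _ k]
      rw [← integral_finsetSum _ fun i _ => integrable_finsetSum _ fun k _ => jSU i k]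
      congr 1
      ext t
      simp only [hS, Finset.sum_mul_sum, Finset.mul_sum _ _ (siteWeight β U z t)]
    rw [e1, Finset.mul_sum]
    simp_rw [← integral_siteWeight_two h hβ z]
    have e2 : ∀ i, ∫ t, siteWeight β U z t * U₂ (z i - t) ≤ C₂ * W := fun i => by
      rw [hWdef, ← integral_const_mul]
      refine integral_mono (integrable_siteWeight_linear h hβ z (C := M)
        (h.cont_two.comp (continuous_const.sub continuous_id)) fun t =>
          (h.bound _).trans (by nlinarith [abs_nonneg t, h.bound_nonneg])) (j0.const_mul _)
        fun t => ?_
      dsimp only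
      rw [mul_comm]
      exact mul_le_mul_of_nonneg_right (hU _) (siteWeight_pos z t).le
    refine (Finset.sum_le_sum fun i _ => e2 i).trans (le_of_eq ?_)
    simp [mul_assoc]
  have emS : W = -β * ∫ t, siteWeight β U z t * ((t - m) * S t) := by
    have := integral_siteWeight_deriv h hβ z (ψ := fun t => t - m) (ψ' := fun _ => 1) (C' := 1)
      (fun t => (hasDerivAt_id t).sub_const m) continuous_const hmD (fun t => by simp)
    simp only [mul_one] at this
    rw [hWdef, this, ← integral_finsetSum _ fun k _ => jmU k]
    simp only [hS, Finset.mul_sum]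
  have em : ∫ t, siteWeight β U z t * ((t - m) * (t - m)) = W₂ - 2 * m * W₁ + m ^ 2 * W := by
    have := integral_linear_combination j2 j1 j0 j0 1 (-(2 * m)) (m ^ 2) 0
    rw [show W₂ - 2 * m * W₁ + m ^ 2 * W = 1 * W₂ + -(2 * m) * W₁ + m ^ 2 * W + 0 * W by ring,
      ← this]
    congr 1
    ext t
    ring
  -- Cramér–Rao argument: the second moment of `βS + a(t - m)` is nonnegative, the square of `βS`
  -- contributes at most `aW`, and the cross term is exactly `-2aW` by integration by parts.
  have hsq : 0 ≤ ∫ t, siteWeight β U z t * ((β * S t + a * (t - m)) * (β * S t + a * (t - m))) :=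
    integral_nonneg fun t => mul_nonneg (siteWeight_pos z t).le (mul_self_nonneg _)
  have esq : ∫ t, siteWeight β U z t * ((β * S t + a * (t - m)) * (β * S t + a * (t - m))) =
      β ^ 2 * (∫ t, siteWeight β U z t * (S t * S t)) +
        2 * a * β * (∫ t, siteWeight β U z t * ((t - m) * S t)) +
        a ^ 2 * ∫ t, siteWeight β U z t * ((t - m) * (t - m)) := by
    have := integral_linear_combination jS jmS jm j0 (β ^ 2) (2 * a * β) (a ^ 2) 0
    rw [zero_mul, add_zero] at this
    rw [← this]
    congr 1
    ext t
    ring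
  rw [esq, em] at hsq
  have hmW : m * W = W₁ := div_mul_cancel₀ _ hW.ne'
  have h1 : β ^ 2 * (∫ t, siteWeight β U z t * (S t * S t)) ≤ a * W := by
    have := mul_le_mul_of_nonneg_left eS hβ.le
    have h2 := mul_le_mul_of_nonneg_right haC hW.le
    linarith
  have h2 : a * W ≤ a ^ 2 * (W₂ - 2 * m * W₁ + m ^ 2 * W) := by
    linear_combination hsq + h1 + 2 * a * emS
  have h3 : W ≤ a * (W₂ - 2 * m * W₁ + m ^ 2 * W) :=
    le_of_mul_le_mul_left (by linarith) ha
  have h4 := mul_le_mul_of_nonneg_left h3 hW.le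
  have h5 : W * (W₂ - 2 * m * W₁ + m ^ 2 * W) = W * W₂ - W₁ ^ 2 := by
    rw [← hmW]; ring
  rw [div_le_iff₀ ha, ← h5]
  linarith

/-- A lower bound for products of increments yields a lower bound for the covariance. -/
theorem covariance_siteWeight_ge (h : IsGradPotential U U₁ U₂ A B M) (hβ : 0 < β)
    (z : K → ℝ) {f g : ℝ → ℝ} (hf : Continuous f) (hg : Continuous g)
    {C D : ℝ} (hfC : ∀ t, |f t| ≤ C * (1 + |t|)) (hgD : ∀ t, |g t| ≤ D * (1 + |t|)) {k e : ℝ}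
    (H : ∀ s t, k * (s - t) ^ 2 + e ≤ (f s - f t) * (g s - g t)) :
    k * ((∫ t, siteWeight β U z t) * (∫ t, siteWeight β U z t * t ^ 2) -
        (∫ t, siteWeight β U z t * t) ^ 2) + e / 2 * (∫ t, siteWeight β U z t) ^ 2 ≤
      (∫ t, siteWeight β U z t) * (∫ t, siteWeight β U z t * (f t * g t)) -
        (∫ t, siteWeight β U z t * f t) * ∫ t, siteWeight β U z t * g t := by
  have j0 : Integrable fun t => siteWeight β U z t := by
    simpa using integrable_siteWeight_linear h hβ z (P := fun _ => 1) continuous_const (C := 1)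
      (fun t => by simp)
  have hid : ∀ t : ℝ, |t| ≤ 1 * (1 + |t|) := fun t => by linarith
  have j1 := integrable_siteWeight_linear h hβ z continuous_id hid
  have j2 := integrable_siteWeight_mul_mul h hβ z continuous_id continuous_id hid hid
  have jf := integrable_siteWeight_linear h hβ z hf hfC
  have jg := integrable_siteWeight_linear h hβ z hg hgD
  have jfg := integrable_siteWeight_mul_mul h hβ z hf hg hfC hgD
  simp only [id, ← sq] at j1 j2
  set W := ∫ t, siteWeight β U z t
  set W₁ := ∫ t, siteWeight β U z t * t
  set W₂ := ∫ t, siteWeight β U z t * t ^ 2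
  set F := ∫ t, siteWeight β U z t * f t
  set G := ∫ t, siteWeight β U z t * g t
  set FG := ∫ t, siteWeight β U z t * (f t * g t)
  -- The average over two independent copies is taken one variable at a time: `s` here, `t`
  -- afterwards. It yields twice the covariance and twice the variance.
  have step : ∀ t, k * (W₂ - 2 * t * W₁ + t ^ 2 * W) + e * W ≤
      FG - f t * G - g t * F + f t * g t * W := by
    intro t
    have := integral_mono
      (integrable_linear_combination j2 j1 j0 j0 k (-(2 * t * k)) (t ^ 2 * k) e)
      (integrable_linear_combination jfg jg jf j0 1 (-f t) (-g t) (f t * g t)) fun s => by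
        have := mul_le_mul_of_nonneg_left (H s t) (siteWeight_pos (β := β) (U := U) z s).le
        dsimp only
        linarith
    rw [integral_linear_combination j2 j1 j0 j0, integral_linear_combination jfg jg jf j0] at this
    linarith
  have := integral_mono
    (integrable_linear_combination j2 j1 j0 j0 (k * W) (-(2 * k * W₁)) (k * W₂) (e * W))
    (integrable_linear_combination jfg jg jf j0 W (-F) (-G) FG) fun t => by
      have := mul_le_mul_of_nonneg_left (step t) (siteWeight_pos (β := β) (U := U) z t).le
      dsimp only
      linarith
  rw [integral_linear_combination j2 j1 j0 j0, integral_linear_combination jfg jg jf j0] at this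
  linarith

end OneSite

/-! ### Convexity of the one-site free energy -/

theorem second_difference_ge {f f₁ f₂ : ℝ → ℝ} (h₁ : ∀ s, HasDerivAt f (f₁ s) s)
    (h₂ : ∀ s, HasDerivAt f₁ (f₂ s) s) {κ : ℝ} (hκ : ∀ s, κ ≤ f₂ s) :
    κ ≤ f 1 + f (-1) - 2 * f 0 := by
  -- Subtracting the parabola leaves a convex function, whose midpoint inequality at `±1` is the
  -- claim.
  have hconv : ConvexOn ℝ Set.univ fun s => f s - κ / 2 * s ^ 2 := by
    have d1 : ∀ s, HasDerivAt (fun s => f s - κ / 2 * s ^ 2) (f₁ s - κ * s) s := fun s =>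
      ((h₁ s).sub ((hasDerivAt_pow 2 s).const_mul (κ / 2))).congr_deriv (by norm_num; ring)
    have d2 : ∀ s, HasDerivAt (fun s => f₁ s - κ * s) (f₂ s - κ) s := fun s =>
      ((h₂ s).sub ((hasDerivAt_id s).const_mul κ)).congr_deriv (by simp)
    have e1 : deriv (fun s => f s - κ / 2 * s ^ 2) = fun s => f₁ s - κ * s :=
      funext fun s => (d1 s).deriv
    refine convexOn_univ_of_deriv2_nonneg (fun s => (d1 s).differentiableAt) ?_ fun s => ?_
    · rw [e1]; exact fun s => (d2 s).differentiableAt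
    · simp only [Function.iterate_succ, Function.iterate_zero, Function.comp_apply, id, e1,
        (d2 s).deriv]
      linarith [hκ s]
  have := hconv.2 (Set.mem_univ 1) (Set.mem_univ (-1)) (show (0 : ℝ) ≤ 1 / 2 by norm_num)
    (show (0 : ℝ) ≤ 1 / 2 by norm_num) (by norm_num)
  norm_num at this
  linarith

theorem sum_sum_sub_sq_mul_eq {K : Type*} [Fintype K] (c : K → K → ℝ) (hc : ∀ i j, c i j = c j i)
    (w : K → ℝ) :
    ∑ i, ∑ j, (w i - w j) ^ 2 * c i j =
      2 * ∑ i, ∑ j, w i ^ 2 * c i j - 2 * ∑ i, ∑ j, w i * w j * c i j := by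
  have h1 : ∑ i, ∑ j, w j ^ 2 * c i j = ∑ i, ∑ j, w i ^ 2 * c i j := by
    rw [Finset.sum_comm]
    exact Finset.sum_congr rfl fun i _ => Finset.sum_congr rfl fun j _ => by rw [hc]
  have h2 : ∑ i, ∑ j, (w i - w j) ^ 2 * c i j = ∑ i, ∑ j, w i ^ 2 * c i j +
      ∑ i, ∑ j, w j ^ 2 * c i j - 2 * ∑ i, ∑ j, w i * w j * c i j := by
    simp only [Finset.mul_sum, ← Finset.sum_add_distrib, ← Finset.sum_sub_distrib]
    exact Finset.sum_congr rfl fun i _ => Finset.sum_congr rfl fun j _ => by ring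
  rw [h2, h1]
  ring

section SiteHessian

set_option maxSynthPendingDepth 3

variable {E X K : Type*} [NormedAddCommGroup E] [NormedSpace ℝ E]
  [NormedAddCommGroup X] [NormedSpace ℝ X] [Fintype K]
  {β A B M c : ℝ} {U U₁ U₂ : ℝ → ℝ} {ℓ : K → E →L[ℝ] ℝ} {m : K → X →L[ℝ] ℝ}
  [FiniteDimensional ℝ X] [MeasurableSpace X] [BorelSpace X] (μ : Measure X)
  [μ.IsAddHaarMeasure]

theorem integrable_gibbsWeight_smul_score
    (h : IsGradPotential U U₁ U₂ A B M) (hβ : 0 < β) (hc : 0 < c)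
    (hm : ∀ φ, c * ‖φ‖ ^ 2 ≤ ∑ k, m k φ ^ 2) (u : E) :
    Integrable (fun φ => gibbsWeight β U ℓ m u φ • gibbsScore β U₁ ℓ m u φ) μ := by
  obtain ⟨b, hb, hle⟩ := gibbs_locally_dominated (ℓ := ℓ) μ h hβ hc hm (‖u‖ + 1)
  exact hb.mono' (Continuous.uncurry_left
    (f := fun u φ => gibbsWeight β U ℓ m u φ • gibbsScore β U₁ ℓ m u φ) u
    (continuous_gibbsWeight_smul_score h)).aestronglyMeasurable
    (.of_forall fun φ => (hle u (by simp) φ).2.1)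

theorem integrable_gibbsSecond
    (h : IsGradPotential U U₁ U₂ A B M) (hβ : 0 < β) (hc : 0 < c)
    (hm : ∀ φ, c * ‖φ‖ ^ 2 ≤ ∑ k, m k φ ^ 2) (u : E) :
    Integrable (gibbsSecond β U U₁ U₂ ℓ m u) μ := by
  obtain ⟨b, hb, hle⟩ := gibbs_locally_dominated (ℓ := ℓ) μ h hβ hc hm (‖u‖ + 1)
  exact hb.mono' (Continuous.uncurry_left (f := gibbsSecond β U U₁ U₂ ℓ m) u
    (continuous_gibbs_second h)).aestronglyMeasurable
    (.of_forall fun φ => (hle u (by simp) φ).2.2)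

/-- The first derivative of the partition function along a line. -/
theorem hasDerivAt_integral_gibbsWeight_line
    (h : IsGradPotential U U₁ U₂ A B M) (hβ : 0 < β) (hc : 0 < c)
    (hm : ∀ φ, c * ‖φ‖ ^ 2 ≤ ∑ k, m k φ ^ 2) (u w : E) (s : ℝ) :
    HasDerivAt (fun s : ℝ => ∫ φ, gibbsWeight β U ℓ m (u + s • w) φ ∂μ)
      (∫ φ, gibbsWeight β U ℓ m (u + s • w) φ * gibbsScore β U₁ ℓ m (u + s • w) φ w ∂μ) s := by
  have hline : HasDerivAt (fun s : ℝ => u + s • w) w s := by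
    simpa using ((hasDerivAt_id s).smul_const w).const_add u
  have := (hasFDerivAt_integral_gibbsWeight (ℓ := ℓ) μ h hβ hc hm (u + s • w)).comp_hasDerivAt s
    hline
  rw [ContinuousLinearMap.integral_apply
    (integrable_gibbsWeight_smul_score (ℓ := ℓ) μ h hβ hc hm (u + s • w))] at this
  exact this

/-- The second derivative of the partition function along a line. -/
theorem hasDerivAt_integral_gibbsWeight_score_line
    (h : IsGradPotential U U₁ U₂ A B M) (hβ : 0 < β) (hc : 0 < c)
    (hm : ∀ φ, c * ‖φ‖ ^ 2 ≤ ∑ k, m k φ ^ 2) (u w : E) (s : ℝ) :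
    HasDerivAt (fun s : ℝ => ∫ φ, gibbsWeight β U ℓ m (u + s • w) φ *
        gibbsScore β U₁ ℓ m (u + s • w) φ w ∂μ)
      (∫ φ, gibbsSecond β U U₁ U₂ ℓ m (u + s • w) φ w w ∂μ) s := by
  have hline : HasDerivAt (fun s : ℝ => u + s • w) w s := by
    simpa using ((hasDerivAt_id s).smul_const w).const_add u
  have i2 := integrable_gibbsSecond (ℓ := ℓ) μ h hβ hc hm (u + s • w)
  have i3 : Integrable (fun φ => gibbsSecond β U U₁ U₂ ℓ m (u + s • w) φ w) μ :=
    i2.apply_continuousLinearMap w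
  have h0 : HasDerivAt (fun s : ℝ => ∫ φ, gibbsWeight β U ℓ m (u + s • w) φ •
      gibbsScore β U₁ ℓ m (u + s • w) φ ∂μ)
      (∫ φ, gibbsSecond β U U₁ U₂ ℓ m (u + s • w) φ w ∂μ) s := by
    rw [← ContinuousLinearMap.integral_apply i2]
    exact HasFDerivAt.comp_hasDerivAt s
      (hasFDerivAt_integral_gibbsWeight_score (ℓ := ℓ) μ h hβ hc hm (u + s • w)) hline
  have h1 : HasDerivAt (fun s : ℝ => (∫ φ, gibbsWeight β U ℓ m (u + s • w) φ •
      gibbsScore β U₁ ℓ m (u + s • w) φ ∂μ) w)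
      ((∫ φ, gibbsSecond β U U₁ U₂ ℓ m (u + s • w) φ w ∂μ) w) s :=
    HasFDerivAt.comp_hasDerivAt s (ContinuousLinearMap.apply ℝ ℝ w).hasFDerivAt h0
  rw [ContinuousLinearMap.integral_apply i3] at h1
  refine h1.congr_of_eventuallyEq (.of_forall fun s => ?_)
  exact (ContinuousLinearMap.integral_apply
    (integrable_gibbsWeight_smul_score (ℓ := ℓ) μ h hβ hc hm (u + s • w)) w).symm

end SiteHessian

section OneSite

variable {K : Type*} [Fintype K] [Nonempty K] {U U₁ U₂ : ℝ → ℝ} {A B M β : ℝ}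

/-- The free energy of a single height with neighbouring heights `z`. -/
noncomputable def siteFree (β : ℝ) (U : ℝ → ℝ) (z : K → ℝ) : ℝ :=
  -Real.log (∫ t, siteWeight β U z t)

/-- The mean of `δ²` over two copies is twice the variance, so at least `2/a`; since `k ≥ 0`, the
term `k(δ² - 2/a)` averages to something nonnegative and half of `2L` survives. -/
theorem covariance_site_force_ge (h : IsGradPotential U U₁ U₂ A B M) (hβ : 0 < β)
    {C₂ a k L : ℝ} (hU : ∀ s, U₂ s ≤ C₂) (ha : 0 < a) (haC : β * (Fintype.card K * C₂) ≤ a)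
    (hk : 0 ≤ k) (hinc : ∀ x x' δ, k * (δ ^ 2 - 2 / a) + 2 * L ≤
      (U₁ (x + δ) - U₁ x) * (U₁ (x' + δ) - U₁ x')) (z : K → ℝ) (i j : K) :
    L * (∫ t, siteWeight β U z t) ^ 2 ≤
      (∫ t, siteWeight β U z t) * (∫ t, siteWeight β U z t * (U₁ (z i - t) * U₁ (z j - t))) -
        (∫ t, siteWeight β U z t * U₁ (z i - t)) * ∫ t, siteWeight β U z t * U₁ (z j - t) := by
  have hU₁ : ∀ k, Continuous fun t => U₁ (z k - t) := fun k =>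
    h.cont_one.comp (continuous_const.sub continuous_id)
  obtain ⟨C, -, hC⟩ := h.abs_one_sub_le (z i)
  obtain ⟨D, -, hD⟩ := h.abs_one_sub_le (z j)
  have h1 := covariance_siteWeight_ge h hβ z (hU₁ i) (hU₁ j) hC hD (k := k)
    (e := 2 * L - k * (2 / a)) fun s t => by
      have := hinc (z i - t) (z j - t) (t - s)
      rw [show z i - t + (t - s) = z i - s by ring, show z j - t + (t - s) = z j - s by ring] at this
      refine le_trans (le_of_eq ?_) this
      ring
  have h2 := mul_le_mul_of_nonneg_left (variance_siteWeight_ge h hβ z hU ha haC) hk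
  refine le_trans ?_ h1
  have e : k * ((∫ t, siteWeight β U z t) ^ 2 / a) =
    k * (2 / a) / 2 * (∫ t, siteWeight β U z t) ^ 2 := by ring
  rw [e] at h2
  linarith

/-- Uniform convexity of the free energy of a single site, modulo constants. -/
theorem siteFree_second_difference_ge (h : IsGradPotential U U₁ U₂ A B M) (hβ : 0 < β)
    {C₂ a k L : ℝ} (hU : ∀ s, U₂ s ≤ C₂) (ha : 0 < a) (haC : β * (Fintype.card K * C₂) ≤ a)
    (hk : 0 ≤ k) (hinc : ∀ x x' δ, k * (δ ^ 2 - 2 / a) + 2 * L ≤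
      (U₁ (x + δ) - U₁ x) * (U₁ (x' + δ) - U₁ x')) (z w : K → ℝ) :
    β ^ 2 * L / 2 * ∑ i, ∑ j, (w i - w j) ^ 2 ≤
      siteFree β U (z + w) + siteFree β U (z - w) - 2 * siteFree β U z := by
  set φ : ℝ → ℝ := fun s => ∫ t, siteWeight β U (z + s • w) t with hφ
  set φ₁ : ℝ → ℝ := fun s => ∫ t, siteWeight β U (z + s • w) t * gibbsScore β U₁
    (fun k => ContinuousLinearMap.proj (R := ℝ) (φ := fun _ : K => ℝ) k)
    (fun _ => negFunctional) (z + s • w) t w with hφ₁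
  set φ₂ : ℝ → ℝ := fun s => ∫ t, gibbsSecond β U U₁ U₂
    (fun k => ContinuousLinearMap.proj (R := ℝ) (φ := fun _ : K => ℝ) k)
    (fun _ => negFunctional) (z + s • w) t w w with hφ₂
  have d1 : ∀ s, HasDerivAt φ (φ₁ s) s := fun s =>
    hasDerivAt_integral_gibbsWeight_line volume h hβ one_pos site_coercive z w s
  have d2 : ∀ s, HasDerivAt φ₁ (φ₂ s) s := fun s =>
    hasDerivAt_integral_gibbsWeight_score_line volume h hβ one_pos site_coercive z w s
  have hpos : ∀ s, 0 < φ s := fun s => integral_siteWeight_pos h hβ _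
  have key := second_difference_ge (f := fun s => -Real.log (φ s)) (f₁ := fun s => -(φ₁ s / φ s))
    (f₂ := fun s => -((φ₂ s * φ s - φ₁ s * φ₁ s) / φ s ^ 2))
    (κ := β ^ 2 * L / 2 * ∑ i, ∑ j, (w i - w j) ^ 2)
    (fun s => ((d1 s).log (hpos s).ne').neg)
    (fun s => ((d2 s).div (d1 s) (hpos s).ne').neg) (fun s => by
      set y := z + s • w with hy
      set W := ∫ t, siteWeight β U y t with hW
      have hWφ : φ s = W := rfl
      set a₁ : K → ℝ := fun i => ∫ t, siteWeight β U y t * U₁ (y i - t) with ha₁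
      set a₂ : K → K → ℝ := fun i j => ∫ t, siteWeight β U y t * (U₁ (y i - t) * U₁ (y j - t))
        with ha₂
      choose D hD0 hD using fun k => h.abs_one_sub_le (y k)
      have hU₁ : ∀ k, Continuous fun t => U₁ (y k - t) := fun k =>
        h.cont_one.comp (continuous_const.sub continuous_id)
      have j1 : ∀ i, Integrable fun t => siteWeight β U y t * U₁ (y i - t) := fun i =>
        integrable_siteWeight_linear h hβ y (hU₁ i) (hD i)
      have j2 : ∀ i j, Integrable fun t => siteWeight β U y t * (U₁ (y i - t) * U₁ (y j - t)) :=
        fun i j => integrable_siteWeight_mul_mul h hβ y (hU₁ i) (hU₁ j) (hD i) (hD j)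
      have jU₂ : ∀ i, Integrable fun t => siteWeight β U y t * U₂ (y i - t) := fun i =>
        integrable_siteWeight_linear h hβ y (C := M)
          (h.cont_two.comp (continuous_const.sub continuous_id)) fun t =>
          (h.bound _).trans (by nlinarith [abs_nonneg t, h.bound_nonneg])
      have e1 : φ₁ s = -β * ∑ i, w i * a₁ i := by
        simp only [hφ₁, ha₁, ← integral_const_mul]
        rw [← integral_finsetSum _ fun i _ => (j1 i).const_mul _, ← integral_const_mul]
        congr 1
        ext t
        simp only [gibbsScore, negFunctional_apply, ContinuousLinearMap.proj_apply,
          smul_apply, sum_apply, smul_eq_mul,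
          Finset.mul_sum, ← sub_eq_add_neg]
        exact Finset.sum_congr rfl fun i _ => by ring
      have e2 : φ₂ s = -β * ∑ i, w i ^ 2 * (∫ t, siteWeight β U y t * U₂ (y i - t)) +
          β ^ 2 * ∑ i, ∑ j, w i * w j * a₂ i j := by
        simp only [hφ₂, ha₂, ← integral_const_mul]
        simp_rw [← integral_finsetSum _ fun j _ => (j2 _ j).const_mul _]
        rw [← integral_finsetSum _ fun i _ => integrable_finsetSum _ fun j _ => (j2 i j).const_mul _,
          ← integral_finsetSum _ fun i _ => (jU₂ i).const_mul _, ← integral_const_mul,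
          ← integral_const_mul, ← integral_add]
        · congr 1
          ext t
          simp only [gibbsSecond, gibbsScoreDeriv, gibbsScore, negFunctional_apply,
            ContinuousLinearMap.proj_apply, smul_apply,
            sum_apply, smul_eq_mul, ← sub_eq_add_neg,
            add_apply, ContinuousLinearMap.smulRight_apply]
          have e3 : ∑ i, ∑ j, w i * w j * (siteWeight β U y t * (U₁ (y i - t) * U₁ (y j - t))) =
              siteWeight β U y t * ((∑ i, U₁ (y i - t) * w i) * ∑ i, U₁ (y i - t) * w i) := by
            rw [Finset.sum_mul_sum, Finset.mul_sum]
            refine Finset.sum_congr rfl fun i _ => ?_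
            rw [Finset.mul_sum]
            exact Finset.sum_congr rfl fun j _ => by ring
          have e4 : ∑ i, w i ^ 2 * (siteWeight β U y t * U₂ (y i - t)) =
              siteWeight β U y t * ∑ i, U₂ (y i - t) * w i * w i := by
            rw [Finset.mul_sum]
            exact Finset.sum_congr rfl fun j _ => by ring
          rw [e3, e4]
          change siteWeight β U y t * _ + siteWeight β U y t * _ * _ = _
          ring
        · exact (integrable_finsetSum _ fun i _ => (jU₂ i).const_mul _).const_mul _
        · exact (integrable_finsetSum _ fun i _ => integrable_finsetSum _ fun j _ =>
            (j2 i j).const_mul _).const_mul _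
      -- The second derivatives of `U` are traded for products of forces, so that only the matrix
      -- `a₂` remains.
      have e3 : φ₂ s = -β ^ 2 * ∑ i, ∑ j, w i ^ 2 * a₂ i j +
          β ^ 2 * ∑ i, ∑ j, w i * w j * a₂ i j := by
        rw [e2]
        simp_rw [integral_siteWeight_two h hβ y]
        congr 1
        simp only [Finset.mul_sum, ha₂]
        exact Finset.sum_congr rfl fun i _ => Finset.sum_congr rfl fun j _ => by ring
      have hsum : ∑ i, a₁ i = 0 := sum_integral_siteWeight_one h hβ y
      have hcov : ∀ i j, L * W ^ 2 ≤ W * a₂ i j - a₁ i * a₁ j := fun i j =>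
        covariance_site_force_ge h hβ hU ha haC hk hinc y i j
      have hsymm : ∀ i j, W * a₂ i j - a₁ i * a₁ j = W * a₂ j i - a₁ j * a₁ i := fun i j => by
        have : a₂ i j = a₂ j i := by
          simp only [ha₂]
          congr 1
          ext t
          ring
        rw [this, mul_comm (a₁ i)]
      have hle : L * W ^ 2 * ∑ i, ∑ j, (w i - w j) ^ 2 ≤
          ∑ i, ∑ j, (w i - w j) ^ 2 * (W * a₂ i j - a₁ i * a₁ j) := by
        rw [Finset.mul_sum]
        refine Finset.sum_le_sum fun i _ => ?_
        rw [Finset.mul_sum]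
        refine Finset.sum_le_sum fun j _ => ?_
        rw [mul_comm]
        exact mul_le_mul_of_nonneg_left (hcov i j) (sq_nonneg _)
      rw [sum_sum_sub_sq_mul_eq _ hsymm] at hle
      -- The product of means drops out of this sum because the mean forces add up to zero.
      have e4 : ∑ i, ∑ j, w i ^ 2 * (W * a₂ i j - a₁ i * a₁ j) =
          W * ∑ i, ∑ j, w i ^ 2 * a₂ i j := by
        have : ∑ i, ∑ j, w i ^ 2 * (a₁ i * a₁ j) = 0 := by
          simp_rw [← mul_assoc, ← Finset.mul_sum, hsum, mul_zero]
          simp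
        simp only [mul_sub, Finset.sum_sub_distrib, this, sub_zero]
        simp only [Finset.mul_sum]
        exact Finset.sum_congr rfl fun i _ => Finset.sum_congr rfl fun j _ => by ring
      have e5 : ∑ i, ∑ j, w i * w j * (W * a₂ i j - a₁ i * a₁ j) =
          W * (∑ i, ∑ j, w i * w j * a₂ i j) - (∑ i, w i * a₁ i) * ∑ i, w i * a₁ i := by
        rw [Finset.sum_mul_sum]
        simp only [Finset.mul_sum, ← Finset.sum_sub_distrib]
        exact Finset.sum_congr rfl fun i _ => Finset.sum_congr rfl fun j _ => by ring
      rw [e4, e5] at hle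
      have hW0 : 0 < W := hpos s
      rw [e3, e1, hWφ, ← neg_div, le_div_iff₀ (by positivity)]
      have := mul_le_mul_of_nonneg_left hle (show 0 ≤ β ^ 2 / 2 by positivity)
      linarith)
  simp only [hφ, one_smul, neg_smul, zero_smul, add_zero, ← sub_eq_add_neg] at key
  simp only [siteFree, sub_eq_add_neg] at key ⊢
  exact key

theorem continuous_siteFree (h : IsGradPotential U U₁ U₂ A B M) (hβ : 0 < β) :
    Continuous (siteFree (K := K) β U) := by
  have hd := contDiff_integral_gibbsWeight (E := K → ℝ) (c := 1)
    (ℓ := fun k => ContinuousLinearMap.proj (R := ℝ) (φ := fun _ : K => ℝ) k)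
    (m := fun _ => negFunctional) volume h hβ one_pos site_coercive
  exact (hd.continuous.log fun z => (integral_siteWeight_pos h hβ z).ne').neg

end OneSite

/-! ### Parity and the Dirichlet form on the torus -/

namespace GradModel

section Torus

variable {d N : ℕ}

/-- Moves parity to `ZMod 2`, where adding `±1` flips it by a finite check. -/
theorem even_zmod_iff_castHom (hN : 2 ∣ N) [NeZero N] (a : ZMod N) :
    Even a ↔ ZMod.castHom hN (ZMod 2) a = 0 := by
  constructor
  · rintro ⟨r, rfl⟩
    rw [map_add]
    generalize ZMod.castHom hN (ZMod 2) r = c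
    revert c
    decide
  · intro h
    rw [← ZMod.natCast_zmod_val a, map_natCast, ZMod.natCast_eq_zero_iff] at h
    obtain ⟨k, hk⟩ := h
    refine ⟨(k : ZMod N), ?_⟩
    rw [← ZMod.natCast_zmod_val a, hk]
    push_cast
    ring

theorem isEvenSite_add_unitVec [NeZero N] (hN : Even N) (x : Torus d N) (k : Dir d) :
    IsEvenSite (x + unitVec d N k) ↔ ¬ IsEvenSite x := by
  have h2 : 2 ∣ N := hN.two_dvd
  have key : ∀ b : ZMod 2, (b + 1 = 0 ↔ ¬ b = 0) ∧ (b + -1 = 0 ↔ ¬ b = 0) := by decide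
  unfold IsEvenSite
  rw [even_zmod_iff_castHom h2, even_zmod_iff_castHom h2]
  rcases k with i | i
  · have : ∑ j, (x + unitVec d N (Sum.inl i)) j = ∑ j, x j + 1 := by
      simp [unitVec, Finset.sum_add_distrib]
    rw [this, map_add, map_one]
    exact (key _).1
  · have : ∑ j, (x + unitVec d N (Sum.inr i)) j = ∑ j, x j + -1 := by
      simp [unitVec, Finset.sum_add_distrib]
    rw [this, map_add, map_neg, map_one]
    exact (key _).2

theorem isEvenSite_zero : IsEvenSite (0 : Torus d N) := by
  simp [IsEvenSite]

/-- Translation by a unit vector exchanges sums over odd and even sites. -/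
theorem sum_odd_add_unitVec [NeZero N] (hN : Even N) (k : Dir d) (f : Torus d N → ℝ) :
    ∑ x : Torus d N with ¬ IsEvenSite x, f (x + unitVec d N k) =
      ∑ x : Torus d N with IsEvenSite x, f x := by
  refine Finset.sum_equiv (Equiv.addRight (unitVec d N k)) (fun x => ?_) (fun x _ => rfl)
  simp [isEvenSite_add_unitVec hN]

theorem card_odd_eq_card_even [NeZero N] (hN : Even N) (hd : 0 < d) :
    (Finset.univ.filter fun x : Torus d N => ¬ IsEvenSite x).card =
      (Finset.univ.filter fun x : Torus d N => IsEvenSite x).card := by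
  have := sum_odd_add_unitVec hN (Sum.inl ⟨0, hd⟩) (fun _ => (1 : ℝ))
  simpa using this

theorem card_torus_eq [NeZero N] (hN : Even N) (hd : 0 < d) :
    Fintype.card (Torus d N) = 2 * (Finset.univ.filter fun x : Torus d N => ¬ IsEvenSite x).card := by
  have := Finset.card_filter_add_card_filter_not (s := (Finset.univ : Finset (Torus d N)))
    (fun x => IsEvenSite x)
  rw [Finset.card_univ] at this
  have h2 := card_odd_eq_card_even (d := d) hN hd
  omega

/-- The torus Hamiltonian as a sum over odd sites. -/
theorem torusHam_eq_sum_odd [NeZero N] (hN : Even N) {U : ℝ → ℝ} (hsymm : ∀ s, U (-s) = U s)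
    (φ : Torus d N → ℝ) (u : EuclideanSpace ℝ (Fin d)) :
    torusHam U φ u = ∑ x : Torus d N with ¬ IsEvenSite x, ∑ k : Dir d,
      U (φ (x + unitVec d N k) - φ x + tilt u k) := by
  unfold torusHam
  rw [← Finset.sum_filter_not_add_sum_filter Finset.univ (fun x : Torus d N => IsEvenSite x)]
  simp_rw [Fintype.sum_sum_type, Finset.sum_add_distrib]
  congr 1
  rw [Finset.sum_comm, Finset.sum_comm (s := Finset.univ.filter _)]
  refine Finset.sum_congr rfl fun i _ => ?_
  -- A bond based at an even site is a bond in direction `-i` from its odd endpoint; reversing it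
  -- changes the sign of the argument, which the symmetry of `U` undoes.
  rw [← sum_odd_add_unitVec hN (Sum.inr i)]
  refine Finset.sum_congr rfl fun x _ => ?_
  rw [← hsymm]
  have : x + unitVec d N (Sum.inr i) + unitVec d N (Sum.inl i) = x := by
    simp [unitVec]
  rw [this]
  congr 1
  simp only [tilt]
  ring

/-- The Dirichlet form of a height configuration. -/
noncomputable def dirichlet [NeZero N] (φ : Torus d N → ℝ) : ℝ :=
  ∑ p : Torus d N × Fin d, (φ (p.1 + unitVec d N (Sum.inl p.2)) - φ p.1) ^ 2

/-- Displacements with such a bound form a submonoid containing the positive unit vectors. These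
generate the torus as a monoid, since coordinates modulo `N` are natural multiples of `1`. -/
theorem exists_sq_sub_le_dirichlet [NeZero N] (x : Torus d N) :
    ∃ C : ℝ, 0 ≤ C ∧ ∀ (φ : Torus d N → ℝ) (y : Torus d N),
      (φ (y + x) - φ y) ^ 2 ≤ C * dirichlet φ := by
  have hD : ∀ φ : Torus d N → ℝ, 0 ≤ dirichlet φ := fun φ =>
    Finset.sum_nonneg fun p _ => sq_nonneg _
  let S : AddSubmonoid (Torus d N) :=
    { carrier := {x | ∃ C : ℝ, 0 ≤ C ∧ ∀ (φ : Torus d N → ℝ) (y : Torus d N),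
        (φ (y + x) - φ y) ^ 2 ≤ C * dirichlet φ}
      zero_mem' := ⟨0, le_rfl, fun φ y => by simp⟩
      add_mem' := by
        rintro a b ⟨C, hC, ha⟩ ⟨D, hD, hb⟩
        refine ⟨2 * C + 2 * D, by positivity, fun φ y => ?_⟩
        have h1 := ha φ y
        have h2 := hb φ (y + a)
        rw [← add_assoc]
        nlinarith [sq_nonneg ((φ (y + a + b) - φ (y + a)) - (φ (y + a) - φ y))] }
  have hunit : ∀ i : Fin d, (Pi.single i 1 : Torus d N) ∈ S := fun i =>
    ⟨1, zero_le_one, fun φ y => by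
      rw [one_mul]
      exact Finset.single_le_sum (f := fun p : Torus d N × Fin d =>
        (φ (p.1 + unitVec d N (Sum.inl p.2)) - φ p.1) ^ 2) (fun p _ => sq_nonneg _)
        (Finset.mem_univ (y, i))⟩
  have hx : x ∈ S := by
    rw [← Finset.univ_sum_single x]
    refine S.sum_mem fun i _ => ?_
    have : (Pi.single i (x i) : Torus d N) = (x i).val • (Pi.single i 1 : Torus d N) := by
      rw [← Pi.single_smul]
      simp
    rw [this]
    exact S.nsmul_mem (hunit i) _
  exact hx

/-- Discrete Poincaré inequality for heights pinned at the origin. -/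
theorem exists_sq_le_dirichlet [NeZero N] :
    ∃ C : ℝ, 0 < C ∧ ∀ φ : Torus d N → ℝ, φ 0 = 0 → ∀ x, φ x ^ 2 ≤ C * dirichlet φ := by
  choose C hC h using exists_sq_sub_le_dirichlet (d := d) (N := N)
  have hD : ∀ φ : Torus d N → ℝ, 0 ≤ dirichlet φ := fun φ =>
    Finset.sum_nonneg fun p _ => sq_nonneg _
  have hCsum : 0 ≤ ∑ x, C x := Finset.sum_nonneg fun x _ => hC x
  -- The sum removes the dependence on `x`; the `+ 1` makes the constant strictly positive, as its
  -- inverse is needed for coercivity.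
  refine ⟨∑ x, C x + 1, by positivity, fun φ hφ x => ?_⟩
  have h1 := h x φ 0
  rw [zero_add, hφ, sub_zero] at h1
  refine h1.trans (mul_le_mul_of_nonneg_right ?_ (hD φ))
  have := Finset.single_le_sum (fun y _ => hC y) (Finset.mem_univ x)
  linarith

end Torus

/-! ### Integrating out the odd heights -/

section TorusIntegral

/-- Evaluation at `x` of a height configuration pinned to `0` at the origin. -/
noncomputable def pinnedEval {d N : ℕ} (x : Torus d N) : ({x : Torus d N // x ≠ 0} → ℝ) →L[ℝ] ℝ :=
  if h : x ≠ 0 then ContinuousLinearMap.proj ⟨x, h⟩ else 0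

theorem pinnedEval_apply {d N : ℕ} (x : Torus d N) (φ : {x : Torus d N // x ≠ 0} → ℝ) :
    pinnedEval x φ = extendZero (fun x : Torus d N => x ≠ 0) φ x := by
  unfold pinnedEval extendZero
  split_ifs <;> rfl

variable {d N : ℕ} [NeZero N] {U U₁ U₂ : ℝ → ℝ} {A B M β : ℝ}

/-- The discrete gradient of a pinned height configuration. -/
noncomputable def pinnedGrad (p : Torus d N × Fin d) : ({x : Torus d N // x ≠ 0} → ℝ) →L[ℝ] ℝ :=
  pinnedEval (p.1 + unitVec d N (Sum.inl p.2)) - pinnedEval p.1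

/-- The constant may depend on `N`: it serves integrability, positivity and smoothness, but does not
enter the convexity bound. -/
theorem exists_pinned_coercive :
    ∃ c : ℝ, 0 < c ∧ ∀ φ : {x : Torus d N // x ≠ 0} → ℝ,
      c * ‖φ‖ ^ 2 ≤ ∑ p : Torus d N × Fin d, pinnedGrad p φ ^ 2 := by
  obtain ⟨C, hC, h⟩ := exists_sq_le_dirichlet (d := d) (N := N)
  refine ⟨C⁻¹, by positivity, fun φ => ?_⟩
  set ψ := extendZero (fun x : Torus d N => x ≠ 0) φ with hψ
  have hD : ∑ p : Torus d N × Fin d, pinnedGrad p φ ^ 2 = dirichlet ψ := by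
    simp only [pinnedGrad, dirichlet, hψ, sub_apply, pinnedEval_apply]
  have hD0 : 0 ≤ dirichlet ψ := Finset.sum_nonneg fun p _ => sq_nonneg _
  rw [hD, inv_mul_le_iff₀ hC]
  have h0 : ψ 0 = 0 := by simp [hψ, extendZero]
  have hn : ‖φ‖ ≤ √(C * dirichlet ψ) := by
    rw [pi_norm_le_iff_of_nonneg (Real.sqrt_nonneg _)]
    intro x
    have h1 := h ψ h0 x.1
    have h2 : ψ x.1 = φ x := by simp [hψ, extendZero, x.2]
    rw [h2] at h1
    rw [Real.norm_eq_abs]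
    exact Real.abs_le_sqrt h1
  calc ‖φ‖ ^ 2 ≤ √(C * dirichlet ψ) ^ 2 := by gcongr
    _ = _ := Real.sq_sqrt (by positivity)

theorem exp_torusHam_eq_gibbsWeight (u : EuclideanSpace ℝ (Fin d))
    (φ : {x : Torus d N // x ≠ 0} → ℝ) :
    Real.exp (-β * torusHam U (extendZero (fun x : Torus d N => x ≠ 0) φ) u) =
      gibbsWeight β U (fun p : Torus d N × Fin d => EuclideanSpace.proj (𝕜 := ℝ) p.2)
        pinnedGrad u φ := by
  unfold gibbsWeight torusHam
  rw [Fintype.sum_prod_type]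
  congr 2
  refine Finset.sum_congr rfl fun x _ => Finset.sum_congr rfl fun i _ => ?_
  congr 1
  simp only [pinnedGrad, sub_apply, pinnedEval_apply]
  exact add_comm _ _

theorem torusZ_eq (u : EuclideanSpace ℝ (Fin d)) :
    torusZ d N β U u = ∫ φ, gibbsWeight β U
      (fun p : Torus d N × Fin d => EuclideanSpace.proj (𝕜 := ℝ) p.2) pinnedGrad u φ := by
  simp only [torusZ, exp_torusHam_eq_gibbsWeight]

theorem torusZ_pos (h : IsGradPotential U U₁ U₂ A B M) (hβ : 0 < β)
    (u : EuclideanSpace ℝ (Fin d)) : 0 < torusZ d N β U u := by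
  obtain ⟨c, hc, hm⟩ := exists_pinned_coercive (d := d) (N := N)
  rw [torusZ_eq]
  exact integral_gibbsWeight_pos volume h hβ hc hm u

theorem integrable_exp_torusHam (h : IsGradPotential U U₁ U₂ A B M) (hβ : 0 < β)
    (u : EuclideanSpace ℝ (Fin d)) :
    Integrable fun φ : {x : Torus d N // x ≠ 0} → ℝ =>
      Real.exp (-β * torusHam U (extendZero (fun x : Torus d N => x ≠ 0) φ) u) := by
  obtain ⟨c, hc, hm⟩ := exists_pinned_coercive (d := d) (N := N)
  simp only [exp_torusHam_eq_gibbsWeight]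
  exact integrable_gibbsWeight volume h hβ hc hm u

theorem contDiff_torusZ (h : IsGradPotential U U₁ U₂ A B M) (hβ : 0 < β) :
    ContDiff ℝ 2 (torusZ d N β U) := by
  obtain ⟨c, hc, hm⟩ := exists_pinned_coercive (d := d) (N := N)
  rw [show torusZ d N β U = _ from funext torusZ_eq]
  exact contDiff_integral_gibbsWeight volume h hβ hc hm

/-- Sites off the origin split into even sites off the origin and odd sites. -/
def evenOddEquiv : {x : Torus d N // IsEvenSite x ∧ x ≠ 0} ⊕ {x : Torus d N // ¬ IsEvenSite x} ≃
    {x : Torus d N // x ≠ 0} where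
  toFun := Sum.elim (fun x => ⟨x.1, x.2.2⟩)
    (fun x => ⟨x.1, fun h => x.2 (h ▸ isEvenSite_zero)⟩)
  invFun x := if h : IsEvenSite x.1 then Sum.inl ⟨x.1, h, x.2⟩ else Sum.inr ⟨x.1, h⟩
  left_inv := by
    rintro (x | x)
    · simp [x.2.1]
    · simp [x.2]
  right_inv x := by
    by_cases h : IsEvenSite x.1 <;> simp [h]

/-- Pinned height configurations as pairs of even and odd height configurations. -/
noncomputable def evenOddSplit :
    ({x : Torus d N // IsEvenSite x ∧ x ≠ 0} → ℝ) × ({x : Torus d N // ¬ IsEvenSite x} → ℝ) ≃ᵐ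
      ({x : Torus d N // x ≠ 0} → ℝ) :=
  (MeasurableEquiv.sumPiEquivProdPi fun _ => ℝ).symm.trans
    (MeasurableEquiv.piCongrLeft (fun _ => ℝ) evenOddEquiv)

theorem measurePreserving_evenOddSplit :
    MeasurePreserving (evenOddSplit (d := d) (N := N)) :=
  (volume_measurePreserving_piCongrLeft (fun _ => ℝ) evenOddEquiv).comp
    (volume_measurePreserving_sumPiEquivProdPi_symm fun _ => ℝ)

theorem evenOddSplit_apply (p : ({x : Torus d N // IsEvenSite x ∧ x ≠ 0} → ℝ) ×
    ({x : Torus d N // ¬ IsEvenSite x} → ℝ))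
    (y : {x : Torus d N // IsEvenSite x ∧ x ≠ 0} ⊕ {x : Torus d N // ¬ IsEvenSite x}) :
    evenOddSplit p (evenOddEquiv y) = Sum.elim p.1 p.2 y := by
  simp only [evenOddSplit, MeasurableEquiv.trans_apply, MeasurableEquiv.coe_piCongrLeft]
  rw [Equiv.piCongrLeft_apply_apply (P := fun _ => ℝ)]
  rcases y with y | y <;> rfl

theorem extendZero_evenOddSplit_even (a : {x : Torus d N // IsEvenSite x ∧ x ≠ 0} → ℝ)
    (b : {x : Torus d N // ¬ IsEvenSite x} → ℝ) {x : Torus d N} (hx : IsEvenSite x) :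
    extendZero (fun x : Torus d N => x ≠ 0) (evenOddSplit (a, b)) x =
      extendZero (fun x : Torus d N => IsEvenSite x ∧ x ≠ 0) a x := by
  by_cases h0 : x = 0
  · simp [extendZero, h0]
  · have := evenOddSplit_apply (a, b) (Sum.inl ⟨x, hx, h0⟩)
    simp only [extendZero, h0, hx, ne_eq, not_false_eq_true, and_self, dite_true]
    exact this

theorem extendZero_evenOddSplit_odd (a : {x : Torus d N // IsEvenSite x ∧ x ≠ 0} → ℝ)
    (b : {x : Torus d N // ¬ IsEvenSite x} → ℝ) (x : {x : Torus d N // ¬ IsEvenSite x}) :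
    extendZero (fun x : Torus d N => x ≠ 0) (evenOddSplit (a, b)) x.1 = b x := by
  have h0 : x.1 ≠ 0 := fun h => x.2 (h ▸ isEvenSite_zero)
  have := evenOddSplit_apply (a, b) (Sum.inr x)
  simp only [extendZero, h0, ne_eq, not_false_eq_true, dite_true]
  exact this

/-- With all bonds grouped at their odd endpoints, each odd height occurs in one factor only, which
is what makes the odd integral a product of one-site integrals. -/
theorem exp_torusHam_evenOddSplit (hN : Even N) (hsymm : ∀ s, U (-s) = U s)
    (u : EuclideanSpace ℝ (Fin d)) (a : {x : Torus d N // IsEvenSite x ∧ x ≠ 0} → ℝ)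
    (b : {x : Torus d N // ¬ IsEvenSite x} → ℝ) :
    Real.exp (-β * torusHam U (extendZero (fun x : Torus d N => x ≠ 0) (evenOddSplit (a, b))) u) =
      ∏ x : {x : Torus d N // ¬ IsEvenSite x}, siteWeight β U (fun k =>
        extendZero (fun x : Torus d N => IsEvenSite x ∧ x ≠ 0) a (x.1 + unitVec d N k) +
          tilt u k) (b x) := by
  simp_rw [siteWeight_eq]
  rw [← Real.exp_sum, ← Finset.mul_sum, torusHam_eq_sum_odd hN hsymm,
    Finset.sum_subtype (p := fun x => ¬ IsEvenSite x) _ (fun x => by simp)]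
  congr 2
  refine Finset.sum_congr rfl fun x _ => Finset.sum_congr rfl fun k _ => ?_
  rw [extendZero_evenOddSplit_odd, extendZero_evenOddSplit_even _ _
    ((isEvenSite_add_unitVec hN x.1 k).2 x.2)]
  congr 1
  ring

theorem oddPotential_eq (y : Dir d → ℝ) (u : EuclideanSpace ℝ (Fin d)) :
    oddPotential β U y u = siteFree β U (fun k => y k + tilt u k) := by
  simp only [oddPotential, siteFree, siteWeight_eq]
  congr 4
  ext t
  congr 2
  exact Finset.sum_congr rfl fun k _ => by ring_nf

theorem exp_neg_evenHam (hd : 0 < d) (h : IsGradPotential U U₁ U₂ A B M) (hβ : 0 < β)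
    (u : EuclideanSpace ℝ (Fin d)) (φ : Torus d N → ℝ) :
    Real.exp (-evenHam β U φ u) = ∏ x : {x : Torus d N // ¬ IsEvenSite x},
      ∫ t, siteWeight β U (fun k => φ (x.1 + unitVec d N k) + tilt u k) t := by
  have : Nonempty (Dir d) := ⟨Sum.inl ⟨0, hd⟩⟩
  rw [evenHam, ← Finset.sum_neg_distrib, Real.exp_sum,
    Finset.prod_subtype (p := fun x => ¬ IsEvenSite x) _ (fun x => by simp)]
  refine Finset.prod_congr rfl fun x _ => ?_
  rw [oddPotential_eq, siteFree, neg_neg, Real.exp_log (integral_siteWeight_pos h hβ _)]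

theorem integral_odd_exp_torusHam (hd : 0 < d) (hN : Even N)
    (hsymm : ∀ s, U (-s) = U s) (h : IsGradPotential U U₁ U₂ A B M) (hβ : 0 < β)
    (u : EuclideanSpace ℝ (Fin d)) (a : {x : Torus d N // IsEvenSite x ∧ x ≠ 0} → ℝ) :
    ∫ b, Real.exp (-β * torusHam U
        (extendZero (fun x : Torus d N => x ≠ 0) (evenOddSplit (a, b))) u) =
      Real.exp (-evenHam β U (extendZero (fun x : Torus d N => IsEvenSite x ∧ x ≠ 0) a) u) := by
  simp_rw [exp_torusHam_evenOddSplit hN hsymm]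
  rw [exp_neg_evenHam hd h hβ]
  exact integral_fintype_prod_volume_eq_prod (fun x : {x : Torus d N // ¬ IsEvenSite x} =>
    siteWeight β U fun k =>
      extendZero (fun x : Torus d N => IsEvenSite x ∧ x ≠ 0) a (x.1 + unitVec d N k) + tilt u k)

theorem integrable_exp_torusHam_split (h : IsGradPotential U U₁ U₂ A B M) (hβ : 0 < β)
    (u : EuclideanSpace ℝ (Fin d)) :
    Integrable (fun p => Real.exp (-β * torusHam U
      (extendZero (fun x : Torus d N => x ≠ 0) (evenOddSplit p)) u)) (volume.prod volume) :=
  (measurePreserving_evenOddSplit.integrable_comp_emb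
    evenOddSplit.measurableEmbedding).2 (integrable_exp_torusHam h hβ u)

theorem integrable_exp_neg_evenHam (hd : 0 < d) (hN : Even N)
    (hsymm : ∀ s, U (-s) = U s) (h : IsGradPotential U U₁ U₂ A B M) (hβ : 0 < β)
    (u : EuclideanSpace ℝ (Fin d)) :
    Integrable fun a : {x : Torus d N // IsEvenSite x ∧ x ≠ 0} → ℝ =>
      Real.exp (-evenHam β U (extendZero (fun x : Torus d N => IsEvenSite x ∧ x ≠ 0) a) u) := by
  have := (integrable_exp_torusHam_split (d := d) (N := N) h hβ u).integral_prod_left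
  simpa only [integral_odd_exp_torusHam hd hN hsymm h hβ] using this

/-- Integrating out the odd heights. -/
theorem torusZ_eq_evenZ (hd : 0 < d) (hN : Even N)
    (hsymm : ∀ s, U (-s) = U s) (h : IsGradPotential U U₁ U₂ A B M) (hβ : 0 < β)
    (u : EuclideanSpace ℝ (Fin d)) : torusZ d N β U u = evenZ d N β U u := by
  unfold torusZ evenZ
  rw [← measurePreserving_evenOddSplit.integral_comp evenOddSplit.measurableEmbedding,
    Measure.volume_eq_prod, integral_prod _ (integrable_exp_torusHam_split h hβ u)]
  simp only [integral_odd_exp_torusHam hd hN hsymm h hβ]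

theorem continuous_evenHam (hd : 0 < d) (h : IsGradPotential U U₁ U₂ A B M) (hβ : 0 < β)
    (u : EuclideanSpace ℝ (Fin d)) :
    Continuous fun a : {x : Torus d N // IsEvenSite x ∧ x ≠ 0} → ℝ =>
      evenHam β U (extendZero (fun x : Torus d N => IsEvenSite x ∧ x ≠ 0) a) u := by
  have : Nonempty (Dir d) := ⟨Sum.inl ⟨0, hd⟩⟩
  have hext : ∀ x : Torus d N, Continuous fun a : {x : Torus d N // IsEvenSite x ∧ x ≠ 0} → ℝ =>
      extendZero (fun x : Torus d N => IsEvenSite x ∧ x ≠ 0) a x := fun x => by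
    unfold extendZero
    split_ifs
    · exact continuous_apply _
    · exact continuous_const
  unfold evenHam
  simp only [oddPotential_eq]
  exact continuous_finsetSum _ fun x _ => (continuous_siteFree h hβ).comp
    (continuous_pi fun k => (hext _).add continuous_const)

end TorusIntegral

end GradModel

/-! ### From second differences to the Hessian -/

/-- The second derivative of a `C²` function is bounded below by its symmetric second
differences. -/
theorem le_hess_of_second_difference {d : ℕ} {f : EuclideanSpace ℝ (Fin d) → ℝ}
    (hf : ContDiff ℝ 2 f) {κ : ℝ}
    (hκ : ∀ u v, κ * ‖v‖ ^ 2 ≤ f (u + v) + f (u - v) - 2 * f u)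
    (u v : EuclideanSpace ℝ (Fin d)) : κ * ‖v‖ ^ 2 ≤ GradModel.hess f u v v := by
  have hline : ∀ s : ℝ, HasDerivAt (fun s : ℝ => u + s • v) v s := fun s => by
    simpa using ((hasDerivAt_id s).smul_const v).const_add u
  have hf1 : ∀ x, HasFDerivAt f (fderiv ℝ f x) x := fun x =>
    (hf.differentiable (by norm_num) x).hasFDerivAt
  have hf2 : ∀ x, HasFDerivAt (fderiv ℝ f) (fderiv ℝ (fderiv ℝ f) x) x := fun x =>
    ((hf.fderiv_right (m := 1) (by norm_num)).differentiable (by norm_num) x).hasFDerivAt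
  set g : ℝ → ℝ := fun s => f (u + s • v) with hg
  set g₁ : ℝ → ℝ := fun s => fderiv ℝ f (u + s • v) v with hg₁
  have d1 : ∀ s, HasDerivAt g (g₁ s) s := fun s => (hf1 _).comp_hasDerivAt s (hline s)
  have d2 : HasDerivAt g₁ (GradModel.hess f u v v) 0 := by
    have h0 := (hf2 (u + (0 : ℝ) • v)).comp_hasDerivAt 0 (hline 0)
    have h1 := HasFDerivAt.comp_hasDerivAt (0 : ℝ) (ContinuousLinearMap.apply ℝ ℝ v).hasFDerivAt h0
    rw [zero_smul, add_zero] at h1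
    exact h1
  set K := κ * ‖v‖ ^ 2 with hK
  set p : ℝ → ℝ := fun s => g s + g (-s) - 2 * g 0 - K * s ^ 2 with hp
  set p₁ : ℝ → ℝ := fun s => g₁ s - g₁ (-s) - 2 * K * s with hp₁
  have hp0 : ∀ s, 0 ≤ p s := fun s => by
    have := hκ u (s • v)
    rw [norm_smul, mul_pow, Real.norm_eq_abs, sq_abs] at this
    simp only [hp, hg, zero_smul, add_zero, neg_smul, ← sub_eq_add_neg]
    linarith
  have dp : ∀ s, HasDerivAt p (p₁ s) s := fun s => by
    have h1 : HasDerivAt (fun s => g (-s)) (g₁ (-s) * -1) s :=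
      (d1 (-s)).comp s (hasDerivAt_neg s)
    have := (((d1 s).add h1).sub_const (2 * g 0)).sub ((hasDerivAt_pow 2 s).const_mul K)
    exact this.congr_deriv (by simp only [hp₁]; norm_num; ring)
  have dp2 : HasDerivAt p₁ (2 * (GradModel.hess f u v v - K)) 0 := by
    have h1 : HasDerivAt (fun s => g₁ (-s)) (GradModel.hess f u v v * -1) 0 := by
      have h2 : HasDerivAt g₁ (GradModel.hess f u v v) (-0) := by rwa [neg_zero]
      exact h2.comp (0 : ℝ) (hasDerivAt_neg 0)
    have := (d2.sub h1).sub ((hasDerivAt_id (0 : ℝ)).const_mul (2 * K))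
    exact this.congr_deriv (by ring)
  have ep : deriv p = p₁ := funext fun s => (dp s).deriv
  -- `p ≥ 0 = p 0`, while a Hessian below `K` would give `p''(0) < 0` and a local maximum at `0`.
  -- Then `p` vanishes near `0`, contradicting `p''(0) < 0`.
  by_contra hlt
  push Not at hlt
  have hmax : IsLocalMax p 0 := by
    refine isLocalMax_of_deriv_deriv_neg ?_ ?_ (dp 0).continuousAt
    · rw [ep, dp2.deriv]; linarith
    · rw [ep]; simp [hp₁]
  have hpz : p 0 = 0 := by simp only [hp, neg_zero]; ring
  have hev : p =ᶠ[nhds 0] fun _ => 0 := by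
    filter_upwards [hmax] with s hs
    exact le_antisymm (hpz ▸ hs) (hp0 s)
  have hev1 : p₁ =ᶠ[nhds 0] fun _ => 0 := by
    rw [← ep]
    simpa using hev.deriv
  have := hev1.deriv_eq
  rw [dp2.deriv, deriv_const] at this
  linarith

/-! ### Joint convexity of the even Hamiltonian and of the surface tension -/

namespace GradModel

section Convexity

variable {d N : ℕ} [NeZero N] {U U₁ U₂ : ℝ → ℝ} {A B M β : ℝ}

theorem tilt_add (u v : EuclideanSpace ℝ (Fin d)) (k : Dir d) :
    tilt (u + v) k = tilt u k + tilt v k := by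
  rcases k with i | i
  · rfl
  · simp [tilt, add_comm]

theorem tilt_sub (u v : EuclideanSpace ℝ (Fin d)) (k : Dir d) :
    tilt (u - v) k = tilt u k - tilt v k := by
  rcases k with i | i
  · rfl
  · simp [tilt]; ring

theorem sum_sum_tilt_sub_sq (v : EuclideanSpace ℝ (Fin d)) :
    ∑ i, ∑ j, (tilt v i - tilt v j) ^ 2 = 8 * d * ‖v‖ ^ 2 := by
  have h1 : ∑ k : Dir d, tilt v k = 0 := by
    simp [Fintype.sum_sum_type, tilt]
  have h2 : ∑ k : Dir d, tilt v k ^ 2 = 2 * ‖v‖ ^ 2 := by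
    rw [EuclideanSpace.norm_sq_eq]
    simp [Fintype.sum_sum_type, tilt, two_mul]
  have h3 := sum_sum_sub_sq_mul_eq (fun _ _ : Dir d => (1 : ℝ)) (fun _ _ => rfl) (tilt v)
  simp only [mul_one] at h3
  rw [h3]
  simp_rw [← Finset.mul_sum, h1, Finset.sum_const, ← Finset.smul_sum, h2]
  simp
  ring

/-- Expand the square and drop the square of the `ψ` difference. The cross term is linear in `ψ`,
and translation by `e_i` or `e_j` turns both sums over odd sites into the same sum over even sites,
so it cancels. -/
theorem sum_odd_gradient_tilt_ge (hN : Even N) (ψ : Torus d N → ℝ)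
    (v : EuclideanSpace ℝ (Fin d)) :
    (Finset.univ.filter fun x : Torus d N => ¬ IsEvenSite x).card * (8 * d * ‖v‖ ^ 2) ≤
      ∑ x : Torus d N with ¬ IsEvenSite x, ∑ i, ∑ j,
        ((ψ (x + unitVec d N i) + tilt v i) - (ψ (x + unitVec d N j) + tilt v j)) ^ 2 := by
  have hle : ∀ x : Torus d N, 8 * d * ‖v‖ ^ 2 + ∑ i, ∑ j, 2 * (tilt v i - tilt v j) *
      (ψ (x + unitVec d N i) - ψ (x + unitVec d N j)) ≤ ∑ i, ∑ j,
        ((ψ (x + unitVec d N i) + tilt v i) - (ψ (x + unitVec d N j) + tilt v j)) ^ 2 := fun x => by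
    rw [← sum_sum_tilt_sub_sq]
    simp only [← Finset.sum_add_distrib]
    refine Finset.sum_le_sum fun i _ => Finset.sum_le_sum fun j _ => ?_
    nlinarith [sq_nonneg (ψ (x + unitVec d N i) - ψ (x + unitVec d N j))]
  have hzero : ∑ x : Torus d N with ¬ IsEvenSite x, ∑ i, ∑ j, 2 * (tilt v i - tilt v j) *
      (ψ (x + unitVec d N i) - ψ (x + unitVec d N j)) = 0 := by
    rw [Finset.sum_comm]
    refine Finset.sum_eq_zero fun i _ => ?_
    rw [Finset.sum_comm]
    refine Finset.sum_eq_zero fun j _ => ?_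
    rw [← Finset.mul_sum, Finset.sum_sub_distrib, sum_odd_add_unitVec hN, sum_odd_add_unitVec hN,
      sub_self, mul_zero]
  refine le_trans (le_of_eq ?_) (Finset.sum_le_sum fun x _ => hle x)
  rw [Finset.sum_add_distrib, hzero, add_zero, Finset.sum_const, nsmul_eq_mul]

/-- Joint uniform convexity of the even Hamiltonian in the heights and the tilt. -/
theorem evenHam_second_difference_ge (hN : Even N) {κ : ℝ} (hκ : 0 ≤ κ)
    (hsite : ∀ z w : Dir d → ℝ, κ * ∑ i, ∑ j, (w i - w j) ^ 2 ≤
      siteFree β U (z + w) + siteFree β U (z - w) - 2 * siteFree β U z)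
    (φ ψ : Torus d N → ℝ) (u v : EuclideanSpace ℝ (Fin d)) :
    κ * ((Finset.univ.filter fun x : Torus d N => ¬ IsEvenSite x).card * (8 * d * ‖v‖ ^ 2)) ≤
      evenHam β U (φ + ψ) (u + v) + evenHam β U (φ - ψ) (u - v) - 2 * evenHam β U φ u := by
  refine (mul_le_mul_of_nonneg_left (sum_odd_gradient_tilt_ge hN ψ v) hκ).trans ?_
  unfold evenHam
  rw [Finset.mul_sum, Finset.mul_sum, ← Finset.sum_add_distrib, ← Finset.sum_sub_distrib]
  refine Finset.sum_le_sum fun x _ => ?_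
  simp only [oddPotential_eq]
  have hadd : (fun k => φ (x + unitVec d N k) + tilt u k) +
      (fun k => ψ (x + unitVec d N k) + tilt v k) =
      fun k => (φ + ψ) (x + unitVec d N k) + tilt (u + v) k := by
    ext k
    simp only [Pi.add_apply, tilt_add]
    ring
  have hsub : (fun k => φ (x + unitVec d N k) + tilt u k) -
      (fun k => ψ (x + unitVec d N k) + tilt v k) =
      fun k => (φ - ψ) (x + unitVec d N k) + tilt (u - v) k := by
    ext k
    simp only [Pi.sub_apply, tilt_sub]
    ring
  have hs := hsite (fun k => φ (x + unitVec d N k) + tilt u k)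
    (fun k => ψ (x + unitVec d N k) + tilt v k)
  rw [hadd, hsub] at hs
  exact hs

/-- Prékopa–Leindler for the even partition function. -/
theorem evenZ_mul_evenZ_le (hd : 0 < d) (hN : Even N) (hsymm : ∀ s, U (-s) = U s)
    (h : IsGradPotential U U₁ U₂ A B M) (hβ : 0 < β) {κ : ℝ} (hκ : 0 ≤ κ)
    (hsite : ∀ z w : Dir d → ℝ, κ * ∑ i, ∑ j, (w i - w j) ^ 2 ≤
      siteFree β U (z + w) + siteFree β U (z - w) - 2 * siteFree β U z)
    (u v : EuclideanSpace ℝ (Fin d)) :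
    evenZ d N β U (u + v) * evenZ d N β U (u - v) ≤ evenZ d N β U u ^ 2 * Real.exp (-(κ *
      ((Finset.univ.filter fun x : Torus d N => ¬ IsEvenSite x).card * (8 * d * ‖v‖ ^ 2)))) := by
  set κ' := κ * ((Finset.univ.filter fun x : Torus d N => ¬ IsEvenSite x).card * (8 * d * ‖v‖ ^ 2))
    with hκ'
  set H : EuclideanSpace ℝ (Fin d) → ({x : Torus d N // IsEvenSite x ∧ x ≠ 0} → ℝ) → ℝ :=
    fun u a => evenHam β U (extendZero (fun x : Torus d N => IsEvenSite x ∧ x ≠ 0) a) u with hH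
  have hc : ∀ u, Continuous (H u) := fun u => continuous_evenHam hd h hβ u
  have hZ : ∀ u, evenZ d N β U u = ∫ a, Real.exp (-H u a) := fun u => rfl
  have hi : ∀ u, Integrable fun a => Real.exp (-H u a) := fun u =>
    integrable_exp_neg_evenHam hd hN hsymm h hβ u
  have hl : ∀ u, ENNReal.ofReal (evenZ d N β U u) = ∫⁻ a, ENNReal.ofReal (Real.exp (-H u a)) :=
    fun u => by
      rw [hZ, ofReal_integral_eq_lintegral_ofReal (hi u) (.of_forall fun a => (Real.exp_pos _).le)]
  have hZ0 : ∀ u, 0 ≤ evenZ d N β U u := fun u => integral_nonneg fun a => (Real.exp_pos _).le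
  have hm : ∀ u, Measurable fun a => ENNReal.ofReal (Real.exp (-H u a)) := fun u =>
    ((Real.continuous_exp.comp (hc u).neg).measurable).ennreal_ofReal
  -- Joint convexity is used at the midpoint of `a` and `b` with increment `(a - b)/2`. The factor
  -- is `exp(-κ'/2)` because the middle function enters Prékopa–Leindler squared.
  have key := lintegral_pi_mul_lintegral_pi_le_sq (hm (u + v)) (hm (u - v))
    ((hm u).const_mul (ENNReal.ofReal (Real.exp (-κ' / 2)))) fun a b => by
      rw [← ENNReal.ofReal_mul (Real.exp_pos _).le, ← ENNReal.ofReal_mul (Real.exp_pos _).le,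
        ← ENNReal.ofReal_pow (by positivity)]
      refine ENNReal.ofReal_le_ofReal ?_
      rw [← Real.exp_add, ← Real.exp_add, ← Real.exp_nat_mul, Real.exp_le_exp]
      have hconv := evenHam_second_difference_ge hN hκ hsite
        (extendZero (fun x : Torus d N => IsEvenSite x ∧ x ≠ 0) fun i => (a i + b i) / 2)
        (extendZero (fun x : Torus d N => IsEvenSite x ∧ x ≠ 0) fun i => (a i - b i) / 2) u v
      have e1 : extendZero (fun x : Torus d N => IsEvenSite x ∧ x ≠ 0) (fun i => (a i + b i) / 2) +
          extendZero (fun x : Torus d N => IsEvenSite x ∧ x ≠ 0) (fun i => (a i - b i) / 2) =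
          extendZero (fun x : Torus d N => IsEvenSite x ∧ x ≠ 0) a := by
        ext x
        simp only [extendZero, Pi.add_apply]
        split_ifs <;> ring
      have e2 : extendZero (fun x : Torus d N => IsEvenSite x ∧ x ≠ 0) (fun i => (a i + b i) / 2) -
          extendZero (fun x : Torus d N => IsEvenSite x ∧ x ≠ 0) (fun i => (a i - b i) / 2) =
          extendZero (fun x : Torus d N => IsEvenSite x ∧ x ≠ 0) b := by
        ext x
        simp only [extendZero, Pi.sub_apply]
        split_ifs <;> ring
      rw [e1, e2] at hconv
      simp only [hH]
      push_cast
      linarith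
  rw [lintegral_const_mul _ (hm u), ← hl, ← hl, ← hl, ← ENNReal.ofReal_mul (hZ0 _),
    ← ENNReal.ofReal_mul (Real.exp_pos _).le, ← ENNReal.ofReal_pow (mul_nonneg (Real.exp_pos _).le
      (hZ0 _)), ENNReal.ofReal_le_ofReal_iff (sq_nonneg _)] at key
  refine key.trans (le_of_eq ?_)
  rw [mul_pow, mul_comm, ← Real.exp_nat_mul]
  congr 2
  push_cast
  ring

/-- The logarithm of the Prékopa–Leindler bound, divided by `|T| = 2n`: this turns `8dκn` into
`4dκ`. -/
theorem torusSigma_second_difference_ge (hd : 0 < d) (hN : Even N) (hsymm : ∀ s, U (-s) = U s)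
    (h : IsGradPotential U U₁ U₂ A B M) (hβ : 0 < β) {κ : ℝ} (hκ : 0 ≤ κ)
    (hsite : ∀ z w : Dir d → ℝ, κ * ∑ i, ∑ j, (w i - w j) ^ 2 ≤
      siteFree β U (z + w) + siteFree β U (z - w) - 2 * siteFree β U z)
    (u v : EuclideanSpace ℝ (Fin d)) :
    4 * d * κ * ‖v‖ ^ 2 ≤ torusSigma d N β U (u + v) + torusSigma d N β U (u - v) -
      2 * torusSigma d N β U u := by
  have hpos : ∀ u, 0 < torusZ d N β U u := torusZ_pos h hβ
  have key := evenZ_mul_evenZ_le hd hN hsymm h hβ hκ hsite u v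
  simp only [← torusZ_eq_evenZ hd hN hsymm h hβ] at key
  set n := (Finset.univ.filter fun x : Torus d N => ¬ IsEvenSite x).card with hn
  have hcard : Fintype.card (Torus d N) = 2 * n := card_torus_eq hN hd
  have hn0 : (0 : ℝ) < n := by
    have : 0 < Fintype.card (Torus d N) := Fintype.card_pos
    rw [hcard] at this
    exact_mod_cast (by omega : 0 < n)
  have hlog := Real.log_le_log (mul_pos (hpos _) (hpos _)) key
  rw [Real.log_mul (hpos _).ne' (hpos _).ne', Real.log_mul (pow_pos (hpos _) 2).ne'
    (Real.exp_pos _).ne', Real.log_pow, Real.log_exp] at hlog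
  push_cast at hlog
  unfold torusSigma
  simp only [Real.log_div (hpos _).ne' (hpos _).ne', hcard]
  push_cast
  rw [← sub_nonneg] at hlog ⊢
  have := mul_nonneg (show (0 : ℝ) ≤ 1 / (2 * n) by positivity) hlog
  refine this.trans (le_of_eq ?_)
  field_simp
  ring

theorem contDiff_torusSigma (h : IsGradPotential U U₁ U₂ A B M) (hβ : 0 < β) :
    ContDiff ℝ 2 (torusSigma d N β U) := by
  have hpos : ∀ u, 0 < torusZ d N β U u := torusZ_pos h hβ
  exact contDiff_const.mul (((contDiff_torusZ h hβ).div_const _).log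
    fun u => (div_pos (hpos _) (hpos _)).ne')

theorem evenSigma_eq (hd : 0 < d) (hN : Even N) (hsymm : ∀ s, U (-s) = U s)
    (h : IsGradPotential U U₁ U₂ A B M) (hβ : 0 < β) :
    evenSigma d N β U = fun u => 2 * torusSigma d N β U u := by
  ext u
  unfold evenSigma torusSigma
  rw [torusZ_eq_evenZ hd hN hsymm h hβ, torusZ_eq_evenZ hd hN hsymm h hβ, card_torus_eq hN hd,
    card_odd_eq_card_even hN hd, Fintype.card_subtype]
  push_cast
  field_simp

theorem hess_const_mul {f : EuclideanSpace ℝ (Fin d) → ℝ} (hf : ContDiff ℝ 2 f) (c : ℝ)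
    (u : EuclideanSpace ℝ (Fin d)) : hess (fun u => c * f u) u = c • hess f u := by
  have h1 : fderiv ℝ (fun u => c * f u) = fun u => c • fderiv ℝ f u := funext fun x =>
    ((hf.differentiable (by norm_num) x).hasFDerivAt.const_mul c).fderiv
  unfold hess
  rw [h1]
  exact (((hf.fderiv_right (m := 1) (by norm_num)).differentiable (by norm_num)
    u).hasFDerivAt.const_smul c).fderiv

end Convexity

end GradModel

/-! ### Application to `U = V + g` and conclusion -/

/-- The force `V' + g'` has the increment bound that yields the covariance lower bound `2 c_l`. -/
theorem exists_increment_bound {V₁ V₂ g₁ g₂ : ℝ → ℝ} (hV : ∀ s, HasDerivAt V₁ (V₂ s) s)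
    (hg : ∀ s, HasDerivAt g₁ (g₂ s) s) (hgc : Continuous g₂) {C₁ C₂ a q : ℝ} (hC₁ : 0 < C₁)
    (hC : C₁ ≤ C₂) (hVC : ∀ s, C₁ ≤ V₂ s ∧ V₂ s ≤ C₂) (hg0 : ∀ s, g₂ s ≤ 0) (ha : 0 < a)
    (hq : 1 ≤ q) (hgq : MemLp g₂ (ENNReal.ofReal q) volume)
    (hsmall : 2 * √(C₁ * C₂) * (GradModel.lqNorm q g₂ * a ^ (1 / (2 * q))) < C₁ ^ 2) :
    ∃ k, 0 ≤ k ∧ ∀ x x' δ : ℝ, k * (δ ^ 2 - 2 / a) +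
      2 * ((C₁ ^ 2 - 2 * √(C₁ * C₂) * (GradModel.lqNorm q g₂ * a ^ (1 / (2 * q)))) / a) ≤
        ((V₁ (x + δ) + g₁ (x + δ)) - (V₁ x + g₁ x)) *
          ((V₁ (x' + δ) + g₁ (x' + δ)) - (V₁ x' + g₁ x')) := by
  obtain ⟨k, hk, hinc⟩ := increment_mul_lower (q := q) hC₁ hC ha ENNReal.toReal_nonneg hq hsmall
  have hVd : Differentiable ℝ V₁ := fun s => (hV s).differentiableAt
  have hgd : Differentiable ℝ g₁ := fun s => (hg s).differentiableAt
  have hVlow : ∀ x δ, 0 ≤ δ → C₁ * δ ≤ V₁ (x + δ) - V₁ x := fun x δ hδ => by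
    have := mul_sub_le_image_sub_of_le_deriv hVd (fun s => by rw [(hV s).deriv]; exact (hVC s).1)
      (show x ≤ x + δ by linarith)
    simpa using this
  have hVup : ∀ x δ, 0 ≤ δ → V₁ (x + δ) - V₁ x ≤ C₂ * δ := fun x δ hδ => by
    have := image_sub_le_mul_sub_of_deriv_le hVd (fun s => by rw [(hV s).deriv]; exact (hVC s).2)
      (show x ≤ x + δ by linarith)
    simpa using this
  have hganti : Antitone g₁ := antitone_of_deriv_nonpos hgd fun s => by
    rw [(hg s).deriv]; exact hg0 s
  have hgup : ∀ x δ, 0 ≤ δ → g₁ x - g₁ (x + δ) ≤ GradModel.lqNorm q g₂ * δ ^ (1 - 1 / q) :=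
    fun x δ hδ => by
      have := abs_sub_le_lqNorm_mul_rpow hg hgc hq hgq (show x ≤ x + δ by linarith)
      rw [abs_sub_comm, add_sub_cancel_left] at this
      exact (le_abs_self _).trans this
  have main : ∀ x x' δ : ℝ, 0 ≤ δ → k * (δ ^ 2 - 2 / a) +
      2 * ((C₁ ^ 2 - 2 * √(C₁ * C₂) * (GradModel.lqNorm q g₂ * a ^ (1 / (2 * q)))) / a) ≤
        ((V₁ (x + δ) + g₁ (x + δ)) - (V₁ x + g₁ x)) *
          ((V₁ (x' + δ) + g₁ (x' + δ)) - (V₁ x' + g₁ x')) := fun x x' δ hδ => by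
    refine (hinc hδ (hVlow x δ hδ) (hVup x δ hδ) (hVlow x' δ hδ) (hVup x' δ hδ)
      (sub_nonneg.2 (hganti (by linarith))) (hgup x δ hδ)
      (sub_nonneg.2 (hganti (by linarith))) (hgup x' δ hδ)).trans (le_of_eq (by ring))
  refine ⟨k, hk, fun x x' δ => ?_⟩
  rcases le_total 0 δ with hδ | hδ
  · exact main x x' δ hδ
  · have := main (x + δ) (x' + δ) (-δ) (by linarith)
    rw [add_neg_cancel_right, add_neg_cancel_right, neg_sq] at this
    linarith

theorem theorem8p2 (d : ℕ) (hd : 0 < d) (β : ℝ) (hβ : 0 < β) (U V g : ℝ → ℝ)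
    (hU : ∀ s, U s = V s + g s)
    (hV : ContDiff ℝ 2 V) (hg : ContDiff ℝ 2 g)
    -- the potential `U` is symmetric
    (hsymm : ∀ s, U (-s) = U s)
    -- (A0)
    (hA0 : ∃ A B : ℝ, 0 < A ∧ ∀ s, A * |s| ^ 2 - B ≤ U s)
    -- (A1)
    (C₀ C₁ C₂ : ℝ) (hC₁ : 0 < C₁) (hC₁₂ : C₁ < C₂) (hC₂₀ : C₂ < C₀)
    (hV2 : ∀ s, C₁ ≤ iteratedDeriv 2 V s ∧ iteratedDeriv 2 V s ≤ C₂)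
    (hg2 : ∀ s, -C₀ ≤ iteratedDeriv 2 g s ∧ iteratedDeriv 2 g s ≤ 0)
    -- (A2)
    (q : ℝ) (hq : 1 ≤ q) (hgq : MemLp (iteratedDeriv 2 g) (ENNReal.ofReal q) volume)
    (hA2 : β ^ (1 / (2 * q)) * GradModel.lqNorm q (iteratedDeriv 2 g) <
      C₁ ^ (3 / 2 : ℝ) / (2 * C₂ ^ ((q + 1) / (2 * q)) * (2 * d : ℝ) ^ (1 / (2 * q)))) :
    0 < GradModel.covLower d β C₁ C₂ q (GradModel.lqNorm q (iteratedDeriv 2 g)) ∧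
    ∀ (N : ℕ) [NeZero N], Even N →
      ContDiff ℝ 2 (GradModel.torusSigma d N β U) ∧
      ContDiff ℝ 2 (GradModel.evenSigma d N β U) ∧
      ∀ u : EuclideanSpace ℝ (Fin d),
        GradModel.hess (GradModel.torusSigma d N β U) u =
          (1 / 2 : ℝ) • GradModel.hess (GradModel.evenSigma d N β U) u ∧
        ∀ v : EuclideanSpace ℝ (Fin d),
          4 * d * β ^ 2 *
              GradModel.covLower d β C₁ C₂ q (GradModel.lqNorm q (iteratedDeriv 2 g)) * ‖v‖ ^ 2 ≤
            GradModel.hess (GradModel.torusSigma d N β U) u v v := by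
  have deriv_facts : ∀ {f : ℝ → ℝ}, ContDiff ℝ 2 f → (∀ s, HasDerivAt f (deriv f s) s) ∧
      (∀ s, HasDerivAt (deriv f) (iteratedDeriv 2 f s) s) ∧ Continuous (iteratedDeriv 2 f) := by
    intro f hf
    have h1 : ContDiff ℝ 1 (deriv f) := hf.deriv' 
    refine ⟨fun s => (hf.differentiable (by norm_num) s).hasDerivAt, fun s => ?_,
      hf.continuous_iteratedDeriv 2 le_rfl⟩
    rw [iteratedDeriv_succ, iteratedDeriv_one]
    exact (h1.differentiable (by norm_num) s).hasDerivAt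
  obtain ⟨hV1, hV2', hVc⟩ := deriv_facts hV
  obtain ⟨hg1, hg2', hgc⟩ := deriv_facts hg
  have hC₂ : 0 < C₂ := hC₁.trans hC₁₂
  have hd' : (0 : ℝ) < d := by exact_mod_cast hd
  obtain ⟨A, B, hA, hAB⟩ := hA0
  have hUfun : U = fun s => V s + g s := funext hU
  have hpot : IsGradPotential U (fun s => deriv V s + deriv g s)
      (fun s => iteratedDeriv 2 V s + iteratedDeriv 2 g s) A B (C₂ + C₀) :=
    { deriv_one := fun s => by rw [hUfun]; exact (hV1 s).add (hg1 s)
      deriv_two := fun s => (hV2' s).add (hg2' s)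
      cont_two := hVc.add hgc
      bound := fun s => by
        have h1 := hV2 s
        have h2 := hg2 s
        rw [abs_le]
        constructor <;> linarith
      pos := hA
      lower := fun s => by simpa using hAB s }
  set G := GradModel.lqNorm q (iteratedDeriv 2 g) with hG
  -- Upper bound for the second derivative of the one-site potential: `2d` neighbours, each
  -- contributing at most `βC₂` because `g'' ≤ 0`.
  set a : ℝ := 2 * d * C₂ * β with ha
  have ha0 : 0 < a := by positivity
  have hsmall := small_of_norm_condition hd hβ hC₁ hC₂ hq hA2
  have hcov := two_mul_covLower (C₁ := C₁) (G := G) hd hβ hC₂ hq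
  rw [← ha] at hsmall hcov
  have hcpos : 0 < GradModel.covLower d β C₁ C₂ q G := by
    have : 0 < (C₁ ^ 2 - 2 * √(C₁ * C₂) * (G * a ^ (1 / (2 * q)))) / a :=
      div_pos (by linarith) ha0
    linarith
  obtain ⟨k, hk, hinc⟩ := exists_increment_bound hV2' hg2' hgc hC₁ hC₁₂.le hV2
    (fun s => (hg2 s).2) ha0 hq hgq hsmall
  rw [← hG, ← hcov] at hinc
  have : Nonempty (GradModel.Dir d) := ⟨Sum.inl ⟨0, hd⟩⟩
  -- The covariance bound is `L = 2c_l`, so the constant `β²L/2` becomes `β²c_l`.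
  have hsite : ∀ z w : GradModel.Dir d → ℝ,
      β ^ 2 * GradModel.covLower d β C₁ C₂ q G * ∑ i, ∑ j, (w i - w j) ^ 2 ≤
        siteFree β U (z + w) + siteFree β U (z - w) - 2 * siteFree β U z := fun z w => by
    have := siteFree_second_difference_ge hpot hβ (C₂ := C₂)
      (fun s => by linarith [(hV2 s).2, (hg2 s).2]) ha0
      (le_of_eq (by rw [ha]; simp; ring)) hk hinc z w
    refine le_trans (le_of_eq ?_) this
    ring
  refine ⟨hcpos, fun N _ hN => ?_⟩
  have hσ : ContDiff ℝ 2 (GradModel.torusSigma d N β U) := GradModel.contDiff_torusSigma hpot hβ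
  have hev := GradModel.evenSigma_eq (N := N) hd hN hsymm hpot hβ
  refine ⟨hσ, by rw [hev]; exact contDiff_const.mul hσ, fun u => ⟨?_, fun v => ?_⟩⟩
  · rw [hev, GradModel.hess_const_mul hσ, smul_smul]
    norm_num
  · refine le_hess_of_second_difference hσ (fun u v => ?_) u v
    have := GradModel.torusSigma_second_difference_ge hd hN hsymm hpot hβ
      (by positivity) hsite u v
    refine le_trans (le_of_eq ?_) this
    ring
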